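/- Let $\mathbb D$ be the open unit disc, let $\mathbb C_\infty$ be the Riemann sphere, and let $g:\mathbb D\to\mathbb C$ be univalent (holomorphic and injective), with image $\Omega=g(\mathbb D)$. Let $\sigma\in\partial\mathbb D$, and let $(w_n)_{n\ge 0}\subset\mathbb D$ be a sequence that converges non-tangentially to $\sigma$, that is, $w_n\to\sigma$ and there is $M$ with $|\sigma-w_n|<M(1-|w_n|)$ for all $n$. Suppose that there is $C>0$ with $k_{\mathbb D}(w_n,w_{n+1})\le C$ for all $n$, where $k_{\mathbb D}$ is the hyperbolic (Poincaré) distance of $\mathbb D$. A crosscut of $\Omega$ is an open Jordan arc in $\Omega$ that extends continuously to its two (possibly equal) end points, which lie on the boundary of $\Omega$ in $\mathbb C_\infty$. A null-chain of $\Omega$ is a sequence $(C_n)_{n\ge0}$ of crosscuts such that the closures in $\mathbb C_\infty$ of $C_n$ and $C_{n+1}$ are disjoint for every $n\ge 0$, $C_n$ separates $C_0$ from $C_{n+1}$ in $\Omega$ for every $n\ge1$, and the spherical diameter of $C_n$ tends to $0$. For $n\ge1$ let $V_n$ be the component of $\Omega\setminus C_n$ that does not contain $C_0$. Two null-chains $(C_n)$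 and $(C_n')$, with components $V_n$ and $V_n'$, are equivalent if for every $m\ge1$ there are $n,n'\ge1$ with $V'_n\subseteq V_m$ and $V_{n'}\subseteq V'_m$. A prime end of $\Omega$ is an equivalence class of null-chains. Then there is exactly one prime end $\hat g(\underline\sigma)$ of $\Omega$ corresponding to $\sigma$, meaning that for every null-chain representing it and every $n\ge1$ one has $g(z)\in V_n$ for all $z\in\mathbb D$ close enough to $\sigma$; and $$\Pi[\hat g(\underline\sigma)]=\Gamma_R(g;\sigma)=\Gamma_N(g;\sigma)=\Gamma(g;\{w_n\}),$$ where - $\Pi[\hat g(\underline\sigma)]$ (the principal part) is the set of $\zeta\in\mathbb C_\infty$ for which there are a null-chain $(C_n)$ representing $\hat g(\underline\sigma)$ and points $\zeta_n\in C_n$ with $\zeta_n\to\zeta$; - $\Gamma_R(g;\sigma)$ (the radial cluster set) is the set of $p\in\mathbb C_\infty$ for which there is a sequence $(r_n)\subset(0,1)$ with $r_n\to1$ and $g(r_n\sigma)\to p$; - $\Gamma_N(g;\sigma)$ (the non-tangential cluster set) is the set of $p\in\mathbb C_\infty$ for which there is a sequence $(z_n)\subset\mathbb D$ converging non-tangentially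 to $\sigma$ with $g(z_n)\to p$; - $\Gamma(g;\{w_n\})$ is the set of $p\in\mathbb C_\infty$ for which there is a subsequence $(w_{n_k})$ with $g(w_{n_k})\to p$. -/

import Mathlib

open Filter Topology Metric Set

noncomputable section

/-- The hyperbolic (Poincaré, Kobayashi) distance of the unit disc, in the normalization with
density `|dz| / (1 - |z|^2)`, that is `(1/2) log ((1 + ρ) / (1 - ρ))` with
`ρ = |z - w| / |1 - conj(z) w|`. It is used at points of the unit disc only. -/
def hyperbolicDist (z w : ℂ) : ℝ :=
  (1 / 2) * Real.log
    ((1 + ‖z - w‖ / ‖1 - (starRingEnd ℂ) z * w‖) / (1 - ‖z - w‖ / ‖1 - (starRingEnd ℂ) z * w‖))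

/-- The sequence `z` lies in the unit disc and converges non-tangentially to `σ`: it converges
to `σ` inside some Stolz region `{ζ | |σ - ζ| < M (1 - |ζ|)}`. -/
def TendstoNonTangentially (z : ℕ → ℂ) (σ : ℂ) : Prop :=
  (∀ n, z n ∈ ball (0 : ℂ) 1) ∧ Tendsto z atTop (𝓝 σ) ∧
    ∃ M : ℝ, ∀ n, ‖σ - z n‖ < M * (1 - ‖z n‖)

/-- The radial cluster set of `g` at `σ`, in the Riemann sphere `OnePoint ℂ`. -/
def radialClusterSet (g : ℂ → ℂ) (σ : ℂ) : Set (OnePoint ℂ) :=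
  {p | ∃ r : ℕ → ℝ, (∀ n, r n ∈ Ioo (0 : ℝ) 1) ∧ Tendsto r atTop (𝓝 1) ∧
    Tendsto (fun n => (g ((r n : ℂ) * σ) : OnePoint ℂ)) atTop (𝓝 p)}

/-- The non-tangential cluster set of `g` at `σ`, in the Riemann sphere. -/
def nonTangentialClusterSet (g : ℂ → ℂ) (σ : ℂ) : Set (OnePoint ℂ) :=
  {p | ∃ z : ℕ → ℂ, TendstoNonTangentially z σ ∧
    Tendsto (fun n => (g (z n) : OnePoint ℂ)) atTop (𝓝 p)}

/-- The cluster set of the sequence `g (w n)`, in the Riemann sphere. -/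
def sequenceClusterSet (g : ℂ → ℂ) (w : ℕ → ℂ) : Set (OnePoint ℂ) :=
  {p | ∃ φ : ℕ → ℕ, StrictMono φ ∧
    Tendsto (fun k => (g (w (φ k)) : OnePoint ℂ)) atTop (𝓝 p)}

/-- The chordal distance of the Riemann sphere, between finite points. -/
def chordalDist (z w : ℂ) : ℝ :=
  2 * ‖z - w‖ / (Real.sqrt (1 + ‖z‖ ^ 2) * Real.sqrt (1 + ‖w‖ ^ 2))

/-- A set of finite points, seen in the Riemann sphere. -/
def toSphere (A : Set ℂ) : Set (OnePoint ℂ) := (fun z : ℂ => (z : OnePoint ℂ)) '' A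

/-- `C` is a crosscut of the open set `Ω`: an open Jordan arc inside `Ω` which extends
continuously to its two end points, and these lie on the boundary of `Ω` in the Riemann sphere.
As usual the two end points are allowed to coincide. -/
def IsCrosscut (Ω C : Set ℂ) : Prop :=
  C ⊆ Ω ∧ ∃ γ : ℝ → OnePoint ℂ, ContinuousOn γ (Icc 0 1) ∧ InjOn γ (Ioo 0 1) ∧
    γ '' Ioo 0 1 = toSphere C ∧ γ 0 ∈ frontier (toSphere Ω) ∧ γ 1 ∈ frontier (toSphere Ω)

/-- `C` separates `A` from `B` in `Ω`: both are subsets of `Ω \ C`, and no connected component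
of `Ω \ C` meets both. -/
def Separates (Ω C A B : Set ℂ) : Prop :=
  A ⊆ Ω \ C ∧ B ⊆ Ω \ C ∧ ∀ a ∈ A, ∀ b ∈ B, b ∉ connectedComponentIn (Ω \ C) a

/-- A null-chain of `Ω`. -/
structure NullChain (Ω : Set ℂ) where
  /-- The crosscuts of the chain. -/
  cut : ℕ → Set ℂ
  isCrosscut : ∀ n, IsCrosscut Ω (cut n)
  disjoint_closure : ∀ n,
    Disjoint (closure (toSphere (cut n))) (closure (toSphere (cut (n + 1))))
  separates : ∀ n, 1 ≤ n → Separates Ω (cut n) (cut 0) (cut (n + 1))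
  /-- The spherical diameters tend to zero. -/
  diam_tendsto_zero : ∀ ε : ℝ, 0 < ε →
    ∀ᶠ n in atTop, ∀ z ∈ cut n, ∀ w ∈ cut n, chordalDist z w < ε

/-- For `n ≥ 1`, the interior part of the crosscut `C n`: the component of `Ω \ C n` that does
not contain `C 0`. (A crosscut divides a simply connected domain into exactly two components.) -/
def NullChain.interiorPart {Ω : Set ℂ} (C : NullChain Ω) (n : ℕ) : Set ℂ :=
  {z | z ∈ Ω \ C.cut n ∧ ∀ a ∈ C.cut 0, z ∉ connectedComponentIn (Ω \ C.cut n) a}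

/-- Every interior part of each of the two null-chains contains an interior part of the other. -/
def NullChain.Equivalent {Ω : Set ℂ} (C C' : NullChain Ω) : Prop :=
  (∀ m, 1 ≤ m → ∃ n, 1 ≤ n ∧ C'.interiorPart n ⊆ C.interiorPart m) ∧
    (∀ m, 1 ≤ m → ∃ n, 1 ≤ n ∧ C.interiorPart n ⊆ C'.interiorPart m)

/-- Equivalence of null-chains is an equivalence relation. -/
def NullChain.setoid (Ω : Set ℂ) : Setoid (NullChain Ω) where
  r := NullChain.Equivalent
  iseqv :=
    { refl := fun _ => ⟨fun m hm => ⟨m, hm, Subset.rfl⟩, fun m hm => ⟨m, hm, Subset.rfl⟩⟩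
      symm := fun h => ⟨h.2, h.1⟩
      trans := by
        rintro A B C ⟨h1, h2⟩ ⟨h3, h4⟩
        constructor
        · intro m hm
          obtain ⟨n, hn, hs⟩ := h1 m hm
          obtain ⟨k, hk, ht⟩ := h3 n hn
          exact ⟨k, hk, ht.trans hs⟩
        · intro m hm
          obtain ⟨n, hn, hs⟩ := h4 m hm
          obtain ⟨k, hk, ht⟩ := h2 n hn
          exact ⟨k, hk, ht.trans hs⟩ }

/-- A prime end of `Ω` is an equivalence class of null-chains of `Ω`. -/
def PrimeEnd (Ω : Set ℂ) : Type := Quotient (NullChain.setoid Ω)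

/-- The null-chain `C` represents the prime end `p`. -/
def NullChain.Represents {Ω : Set ℂ} (C : NullChain Ω) (p : PrimeEnd Ω) : Prop :=
  (Quotient.mk (NullChain.setoid Ω) C : PrimeEnd Ω) = p

/-- The principal part of a prime end. -/
def PrimeEnd.principalPart {Ω : Set ℂ} (p : PrimeEnd Ω) : Set (OnePoint ℂ) :=
  {x | ∃ C : NullChain Ω, C.Represents p ∧ ∃ ζ : ℕ → ℂ, (∀ n, ζ n ∈ C.cut n) ∧
    Tendsto (fun n => (ζ n : OnePoint ℂ)) atTop (𝓝 x)}

/-- The prime end `p` of `g(𝔻)` corresponds to the boundary point `σ`: it is the value at `σ`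
of the extension of `g` to the boundary that is continuous for the Carathéodory topology, i.e.
`g z → p` as `z → σ` in the disc, i.e. `g z` is eventually in every interior part of every
null-chain that represents `p`. -/
def IsPrimeEndAt (g : ℂ → ℂ) (σ : ℂ) (p : PrimeEnd (g '' ball (0 : ℂ) 1)) : Prop :=
  ∀ C : NullChain (g '' ball (0 : ℂ) 1), C.Represents p →
    ∀ n, 1 ≤ n → ∀ᶠ z in 𝓝[ball (0 : ℂ) 1] σ, g z ∈ C.interiorPart n

end

/-! The problem is moved to the strip |Im ζ| < π/2 by the conformal map `stripToDisc σ`, which sends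
the right end of the strip to σ. With G = g ∘ `stripToDisc σ`, the radius to σ becomes the right
half of the real axis, Stolz regions lie in narrower strips, bounded hyperbolic steps become steps
along which Re ζ grows boundedly, and images of vertical lines supply crosscuts.

Koebe's square root trick gives G = a + (b + 1/F)² with F bounded and univalent
(`exists_bounded_factor`). The map u ↦ a + (b + 1/u)² is continuous into the sphere, hence uniformly
continuous on a closed disc, so planar estimates for F become chordal estimates for G. Since F has
an image of finite area, the length-area method finds, in every unit window far to the right, lines
with short images (`frequently_length_le`). Such an image ends on the boundary. For consecutive
closures to be disjoint the end points must differ; a logarithmic density shows that almost no line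
ends at a prescribed point (`ae_not_tendsto`). This yields null-chains of vertical lines near
prescribed abscissas (`exists_nullChain`).

Uniqueness is `equivalent_of_right_end`: a short crosscut cannot meet two lines whose images have
disjoint closures, so it lies on one side of a line, and connectedness decides which side.

For the principal part, the real axis has to cross the late crosscuts of any chain of this prime end
(`eventually_exists_real_mem_cut`), and these are small, so principal points are limits along the
axis; the converse uses chains placed near given abscissas. Finally the mean value property of F'²
gives F' → 0 in narrower strips, so sequences there at bounded distance have the same limits
(`tendsto_of_narrow`). This identifies all the cluster sets. -/

/-! ### Univalent functions of the disc and the bounded factor -/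

theorem isSimplyConnected_ball (c : ℂ) {r : ℝ} (hr : 0 < r) : IsSimplyConnected (ball c r) := by
  have := (convex_ball c r).contractibleSpace ⟨c, mem_ball_self hr⟩
  exact (inferInstance : SimplyConnectedSpace (ball c r))

/-- An injective holomorphic function on a preconnected open set is an open map. -/
theorem isOpen_image_of_injOn {U s : Set ℂ} {f : ℂ → ℂ} (hU : IsOpen U) (hUc : IsPreconnected U)
    (hf : DifferentiableOn ℂ f U) (hinj : InjOn f U) (hs : s ⊆ U) (hso : IsOpen s) :
    IsOpen (f '' s) := by
  rcases (hf.analyticOnNhd hU).is_constant_or_isOpen hUc with ⟨w, hw⟩ | h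
  · have hsub : U.Subsingleton := fun x hx y hy => hinj hx hy ((hw x hx).trans (hw y hy).symm)
    rcases U.eq_empty_or_nonempty with h | ⟨x, hx⟩
    · have : s = ∅ := by rw [← subset_empty_iff, ← h]; exact hs
      simp [this]
    · exfalso
      obtain ⟨ε, hε, hb⟩ := Metric.isOpen_iff.1 hU x hx
      have h1 : x + (ε / 2 : ℝ) ∈ ball x ε := by
        simp only [mem_ball, dist_self_add_left, Complex.norm_real, Real.norm_eq_abs]
        rw [abs_of_pos (by positivity)]; linarith
      have h2 := hsub (hb h1) hx
      have h3 : ((ε / 2 : ℝ) : ℂ) = 0 := by simpa using h2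
      have h4 : ε / 2 = 0 := by exact_mod_cast h3
      linarith
  · exact h s hs hso

/-- A continuous square root of a nonvanishing holomorphic function is holomorphic. -/
theorem differentiableOn_of_sq {U : Set ℂ} (hU : IsOpen U) {f h : ℂ → ℂ} (hf : ContinuousOn f U)
    (hh : DifferentiableOn ℂ h U) (hfh : ∀ z ∈ U, f z ^ 2 = h z) (h0 : ∀ z ∈ U, h z ≠ 0) :
    DifferentiableOn ℂ f U := by
  intro z hz
  have hfz : f z ≠ 0 := fun h => h0 z hz (by rw [← hfh z hz, h]; simp)
  have hfc : ContinuousAt f z := hf.continuousAt (hU.mem_nhds hz)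
  have hd : HasDerivAt h (deriv h z) z := (hh.differentiableAt (hU.mem_nhds hz)).hasDerivAt
  have : HasDerivAt f (deriv h z / (f z + f z)) z := by
    rw [hasDerivAt_iff_tendsto_slope] at hd ⊢
    have hs : Tendsto (fun y => f y + f z) (𝓝[≠] z) (𝓝 (f z + f z)) :=
      (hfc.tendsto.add_const _).mono_left nhdsWithin_le_nhds
    have hne : f z + f z ≠ 0 := by rw [← two_mul]; simpa using hfz
    refine (hd.div hs hne).congr' ?_
    filter_upwards [self_mem_nhdsWithin, nhdsWithin_le_nhds (hU.mem_nhds hz),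
      hs.eventually_ne hne] with y hy hyU hy0
    have hyz : y - z ≠ 0 := sub_ne_zero.2 hy
    simp only [Pi.div_apply, slope_def_field, ← hfh y hyU, ← hfh z hz]
    field_simp
    ring
  exact this.differentiableAt.differentiableWithinAt

/-- The image of the disc under a univalent function is not the whole plane. -/
theorem image_ball_ne_univ {g : ℂ → ℂ} (hg : DifferentiableOn ℂ g (ball (0 : ℂ) 1))
    (hinj : InjOn g (ball (0 : ℂ) 1)) : g '' ball (0 : ℂ) 1 ≠ univ := by
  intro huniv
  set D := ball (0 : ℂ) 1 with hD
  have hDo : IsOpen D := isOpen_ball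
  have hDc : IsPreconnected D := (convex_ball _ _).isPreconnected
  have hex : ∀ w : ℂ, ∃ z ∈ D, g z = w := fun w => by
    have : w ∈ g '' D := huniv ▸ mem_univ w
    exact this
  choose k hkD hk using hex
  have hkg : ∀ z ∈ D, k (g z) = z := fun z hz => hinj (hkD _) hz (hk _)
  have hkc : Continuous k := by
    refine continuous_def.2 fun s hs => ?_
    have : k ⁻¹' s = g '' (s ∩ D) := by
      ext w
      constructor
      · intro hw; exact ⟨k w, ⟨hw, hkD w⟩, hk w⟩
      · rintro ⟨z, ⟨hzs, hzD⟩, rfl⟩; simpa [hkg z hzD] using hzs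
    rw [this]
    exact isOpen_image_of_injOn hDo hDc hg hinj inter_subset_right (hs.inter hDo)
  have hkd0 : ∀ w, deriv g (k w) ≠ 0 → DifferentiableAt ℂ k w := by
    intro w hw
    exact (HasDerivAt.of_local_left_inverse hkc.continuousAt
      (hg.differentiableAt (hDo.mem_nhds (hkD w))).hasDerivAt hw
      (Eventually.of_forall hk)).differentiableAt
  -- A zero of g' is isolated unless g' vanishes identically, and k maps punctured neighbourhoods
  -- into punctured neighbourhoods. So k is holomorphic near w off w itself, and continuity removes
  -- the singularity.
  have hkd : Differentiable ℂ k := by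
    intro w
    have han : AnalyticAt ℂ (deriv g) (k w) :=
      ((hg.analyticOnNhd hDo).deriv) _ (hkD w)
    rcases han.eventually_eq_zero_or_eventually_ne_zero with h | h
    · exfalso
      have h1 : EqOn (deriv g) 0 D :=
        (hg.analyticOnNhd hDo).deriv.eqOn_zero_of_preconnected_of_eventuallyEq_zero hDc (hkD w) h
      have h3 := hDo.is_const_of_deriv_eq_zero hDc hg h1 (hkD 0) (hkD 1)
      rw [hk, hk] at h3
      exact zero_ne_one h3
    · have h2 : ∀ᶠ w' in 𝓝[≠] w, deriv g (k w') ≠ 0 := by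
        have ht : Tendsto k (𝓝[≠] w) (𝓝[≠] (k w)) := by
          refine tendsto_nhdsWithin_iff.2 ⟨hkc.continuousAt.tendsto.mono_left nhdsWithin_le_nhds, ?_⟩
          filter_upwards [self_mem_nhdsWithin] with w' hw' heq
          exact hw' (by rw [mem_singleton_iff, ← hk w', ← hk w, heq])
        exact ht.eventually h
      rw [eventually_nhdsWithin_iff] at h2
      have h3 := (Complex.differentiableOn_compl_singleton_and_continuousAt_iff (f := k) h2).1
        ⟨fun w' hw' => (hkd0 w' (hw'.1 hw'.2)).differentiableWithinAt, hkc.continuousAt⟩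
      exact h3.differentiableAt h2
  -- Liouville: an entire inverse with values in the disc would be constant.
  have hb : Bornology.IsBounded (range k) :=
    isBounded_ball.subset (range_subset_iff.2 hkD)
  have h01 := hkd.apply_eq_apply_of_bounded hb 0 1
  have : (0 : ℂ) = 1 := by rw [← hk 0, ← hk 1, h01]
  exact zero_ne_one this

/-- A univalent function of the disc is a rational function of degree two
of a bounded univalent function. -/
theorem exists_bounded_factor {g : ℂ → ℂ} (hg : DifferentiableOn ℂ g (ball (0 : ℂ) 1))
    (hinj : InjOn g (ball (0 : ℂ) 1)) :
    ∃ (a b : ℂ) (M : ℝ) (f : ℂ → ℂ), DifferentiableOn ℂ f (ball (0 : ℂ) 1) ∧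
      InjOn f (ball (0 : ℂ) 1) ∧
      ∀ z ∈ ball (0 : ℂ) 1, ‖f z‖ ≤ M ∧ f z ≠ 0 ∧ g z = a + (b + (f z)⁻¹) ^ 2 := by
  obtain ⟨a, ha⟩ := (ne_univ_iff_exists_notMem _).1 (image_ball_ne_univ hg hinj)
  set D := ball (0 : ℂ) 1 with hD
  have hDo : IsOpen D := isOpen_ball
  have hDc : IsPreconnected D := (convex_ball _ _).isPreconnected
  have h0D : (0 : ℂ) ∈ D := mem_ball_self one_pos
  have hga : ∀ z ∈ D, g z - a ≠ 0 := fun z hz h => ha ⟨z, hz, sub_eq_zero.1 h⟩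
  obtain ⟨h, hhc, hh⟩ := Complex.exists_continuousOn_pow_eq (isSimplyConnected_ball 0 one_pos) hDo
    (g := fun z => g z - a) (hg.continuousOn.sub continuousOn_const)
    (by rintro ⟨z, hz, h⟩; exact hga z hz h) two_ne_zero
  have hhd : DifferentiableOn ℂ h D :=
    differentiableOn_of_sq hDo hhc (hg.sub_const a) (fun z _ => hh z) hga
  have hh0 : ∀ z ∈ D, h z ≠ 0 := fun z hz h => hga z hz (by rw [← hh z, h]; simp)
  have hhinj : InjOn h D := fun x hx y hy hxy => hinj hx hy (by
    have := hh x; rw [hxy, hh y] at this; simpa using this.symm)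
  have hopen : IsOpen (h '' D) := isOpen_image_of_injOn hDo hDc hhd hhinj Subset.rfl hDo
  obtain ⟨r, hr, hball⟩ := Metric.isOpen_iff.1 hopen (h 0) ⟨0, h0D, rfl⟩
  -- Koebe's trick: h² is injective and h has no zero, so the image of h is disjoint from its
  -- negative. It contains a disc about h(0), hence omits the disc of the same radius about -h(0).
  have hfar : ∀ z ∈ D, r ≤ ‖h z + h 0‖ := by
    intro z hz
    by_contra! hlt
    have : -h z ∈ ball (h 0) r := by
      rw [mem_ball, dist_eq_norm, ← norm_neg]; simpa [add_comm] using hlt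
    obtain ⟨y, hy, hyz⟩ := hball this
    have hyz' : y = z := hinj hy hz (by
      have := hh y; rw [hyz, neg_sq, hh z] at this; simpa using this.symm)
    subst hyz'
    exact hh0 y hy (self_eq_neg.1 hyz)
  have hne : ∀ z ∈ D, h z + h 0 ≠ 0 := fun z hz h0 => by
    have := hfar z hz; rw [h0, norm_zero] at this; linarith
  refine ⟨a, -h 0, r⁻¹, fun z => (h z + h 0)⁻¹, ?_, ?_, fun z hz => ⟨?_, ?_, ?_⟩⟩
  · exact (hhd.add_const _).inv hne
  · intro x hx y hy hxy
    exact hhinj hx hy (by simpa using hxy)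
  · rw [norm_inv]; exact inv_anti₀ hr (hfar z hz)
  · exact inv_ne_zero (hne z hz)
  · simp [hh z]

/-! ### The Riemann sphere and the chordal distance -/

/-- Stereographic coordinates of the Riemann sphere, with the point at infinity at the origin. -/
noncomputable def sphereCoord (p : OnePoint ℂ) : ℂ × ℝ :=
  p.elim (0, 0) (fun z : ℂ => ((2 / (1 + ‖z‖ ^ 2) : ℝ) • z, 2 / (1 + ‖z‖ ^ 2)))

theorem sphereCoord_coe (z : ℂ) :
    sphereCoord z = ((2 / (1 + ‖z‖ ^ 2) : ℝ) • z, 2 / (1 + ‖z‖ ^ 2)) := rfl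

theorem sphereCoord_infty : sphereCoord (OnePoint.infty : OnePoint ℂ) = (0, 0) := rfl

theorem continuous_sphereCoord : Continuous sphereCoord := by
  rw [OnePoint.continuous_iff]
  constructor
  · simp only [sphereCoord_infty, sphereCoord_coe, coclosedCompact_eq_cocompact]
    have h1 : Tendsto (fun z : ℂ => ‖z‖) (cocompact ℂ) atTop := tendsto_norm_cocompact_atTop
    have h2 : Tendsto (fun z : ℂ => 2 / ‖z‖) (cocompact ℂ) (𝓝 0) := h1.const_div_atTop 2
    have h3 : Tendsto (fun z : ℂ => 2 / (1 + ‖z‖ ^ 2)) (cocompact ℂ) (𝓝 0) :=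
      (tendsto_atTop_add_const_left _ 1
        ((tendsto_pow_atTop two_ne_zero).comp h1)).const_div_atTop 2
    refine Tendsto.prodMk_nhds (squeeze_zero_norm (fun z => ?_) h2) h3
    rw [norm_smul, Real.norm_of_nonneg (by positivity)]
    rcases eq_or_ne z 0 with rfl | hz
    · simp
    · have hz' : 0 < ‖z‖ := norm_pos_iff.2 hz
      rw [div_mul_eq_mul_div, div_le_div_iff₀ (by positivity) hz']
      nlinarith
  · simp only [sphereCoord_coe]
    have : ∀ z : ℂ, 1 + ‖z‖ ^ 2 ≠ 0 := fun z => by positivity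
    fun_prop (disch := exact this _)

theorem injective_sphereCoord : Function.Injective sphereCoord := by
  have hpos : ∀ z : ℂ, (0 : ℝ) < 2 / (1 + ‖z‖ ^ 2) := fun z => by positivity
  intro p q h
  induction p using OnePoint.rec with
  | infty =>
    induction q using OnePoint.rec with
    | infty => rfl
    | coe w => exact absurd (congrArg Prod.snd h) (hpos w).ne
  | coe z =>
    induction q using OnePoint.rec with
    | infty => exact absurd (congrArg Prod.snd h) (hpos z).ne'
    | coe w =>
      rw [sphereCoord_coe, sphereCoord_coe, Prod.mk.injEq] at h
      rw [h.2] at h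
      exact congrArg _ (smul_right_injective ℂ (hpos w).ne' h.1)

theorem isClosedEmbedding_sphereCoord : IsClosedEmbedding sphereCoord :=
  continuous_sphereCoord.isClosedEmbedding injective_sphereCoord

/-- The chordal distance is the Euclidean distance of the stereographic images. The product ℂ × ℝ
carries the sup metric instead, which explains the two one-sided comparisons that follow; the factor
2 there is a crude √2. -/
theorem chordalDist_sq (z w : ℂ) : chordalDist z w ^ 2 =
    ‖(sphereCoord z).1 - (sphereCoord w).1‖ ^ 2 +
      ((sphereCoord z).2 - (sphereCoord w).2) ^ 2 := by
  have hz : (1 + ‖z‖ ^ 2) ≠ 0 := by positivity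
  have hw : (1 + ‖w‖ ^ 2) ≠ 0 := by positivity
  simp only [chordalDist, sphereCoord_coe, div_pow, mul_pow]
  rw [Real.sq_sqrt (by positivity), Real.sq_sqrt (by positivity)]
  have : (2 / (1 + ‖z‖ ^ 2) : ℝ) • z - (2 / (1 + ‖w‖ ^ 2) : ℝ) • w =
      (2 / ((1 + ‖z‖ ^ 2) * (1 + ‖w‖ ^ 2)) : ℝ) • ((1 + ‖w‖ ^ 2) • z - (1 + ‖z‖ ^ 2) • w) := by
    rw [smul_sub, smul_smul, smul_smul]
    congr 2 <;> field_simp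
  rw [this, norm_smul, mul_pow, Real.norm_eq_abs, sq_abs]
  have key : ‖(1 + ‖w‖ ^ 2) • z - (1 + ‖z‖ ^ 2) • w‖ ^ 2 + (‖w‖ ^ 2 - ‖z‖ ^ 2) ^ 2 =
      ‖z - w‖ ^ 2 * ((1 + ‖z‖ ^ 2) * (1 + ‖w‖ ^ 2)) := by
    simp only [← Complex.normSq_eq_norm_sq, Complex.normSq_apply, Complex.sub_re, Complex.sub_im,
      Complex.smul_re, Complex.smul_im, smul_eq_mul]
    ring
  field_simp
  linear_combination -key

theorem chordalDist_nonneg (z w : ℂ) : 0 ≤ chordalDist z w := by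
  unfold chordalDist; positivity

theorem dist_sphereCoord_le (z w : ℂ) : dist (sphereCoord z) (sphereCoord w) ≤ chordalDist z w := by
  rw [Prod.dist_eq, dist_eq_norm, dist_eq_norm]
  have h := chordalDist_sq z w
  refine max_le ?_ ?_ <;> refine le_of_sq_le_sq ?_ (chordalDist_nonneg z w)
  · nlinarith
  · rw [Real.norm_eq_abs, sq_abs]; nlinarith

theorem chordalDist_le (z w : ℂ) :
    chordalDist z w ≤ 2 * dist (sphereCoord z) (sphereCoord w) := by
  have h := chordalDist_sq z w
  have h1 : dist (sphereCoord z).1 (sphereCoord w).1 ≤ dist (sphereCoord z) (sphereCoord w) :=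
    le_max_left _ _
  have h2 : dist (sphereCoord z).2 (sphereCoord w).2 ≤ dist (sphereCoord z) (sphereCoord w) :=
    le_max_right _ _
  rw [dist_eq_norm] at h1 h2
  rw [Real.norm_eq_abs] at h2
  have h3 := pow_le_pow_left₀ (norm_nonneg _) h1 2
  have h4 := pow_le_pow_left₀ (abs_nonneg _) h2 2
  rw [sq_abs] at h4
  refine le_of_sq_le_sq ?_ (by positivity)
  nlinarith

/-- Disjoint closed sets of the Riemann sphere are at a positive chordal distance. -/
theorem exists_chordalDist_gap {A B : Set (OnePoint ℂ)} (hA : IsClosed A) (hB : IsClosed B)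
    (hAB : Disjoint A B) :
    ∃ ε > 0, ∀ x ∈ A, ∀ y ∈ B, ε ≤ dist (sphereCoord x) (sphereCoord y) := by
  obtain ⟨r, hr, h⟩ := exists_pos_forall_lt_edist
    (hA.isCompact.image continuous_sphereCoord)
    (isClosedEmbedding_sphereCoord.isClosedMap B hB)
    ((disjoint_image_iff injective_sphereCoord).2 hAB)
  refine ⟨r, by exact_mod_cast hr, fun x hx y hy => ?_⟩
  have h1 := (h _ (mem_image_of_mem _ hx) _ (mem_image_of_mem _ hy)).le
  rw [edist_dist] at h1
  rwa [ENNReal.le_ofReal_iff_toReal_le (by simp) dist_nonneg] at h1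

theorem tendsto_sphere_of_chordalDist {x y : ℕ → ℂ} {p : OnePoint ℂ}
    (hx : Tendsto (fun n => (x n : OnePoint ℂ)) atTop (𝓝 p))
    (hxy : Tendsto (fun n => chordalDist (x n) (y n)) atTop (𝓝 0)) :
    Tendsto (fun n => (y n : OnePoint ℂ)) atTop (𝓝 p) := by
  rw [isClosedEmbedding_sphereCoord.isInducing.tendsto_nhds_iff] at hx ⊢
  refine (tendsto_iff_of_dist ?_).1 hx
  exact squeeze_zero (fun _ => dist_nonneg) (fun n => dist_sphereCoord_le _ _) hxy

/-! ### The quadratic map from the plane to the sphere -/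

open Classical in
/-- The map `u ↦ a + (b + 1 / u) ^ 2` of the plane to the Riemann sphere. -/
noncomputable def sphereQuad (a b u : ℂ) : OnePoint ℂ :=
  if u = 0 then OnePoint.infty else ((a + (b + u⁻¹) ^ 2 : ℂ) : OnePoint ℂ)

theorem sphereQuad_of_ne {a b u : ℂ} (hu : u ≠ 0) :
    sphereQuad a b u = ((a + (b + u⁻¹) ^ 2 : ℂ) : OnePoint ℂ) := if_neg hu

theorem continuous_sphereQuad (a b : ℂ) : Continuous (sphereQuad a b) := by
  rw [continuous_iff_continuousAt]
  intro u
  rcases eq_or_ne u 0 with rfl | hu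
  · rw [continuousAt_iff_punctured_nhds]
    have h1 : Tendsto (fun u : ℂ => u⁻¹) (𝓝[≠] 0) (Bornology.cobounded ℂ) :=
      tendsto_inv₀_nhdsNE_zero
    have h2 : Tendsto (fun u : ℂ => a + (b + u⁻¹) ^ 2) (𝓝[≠] 0) (Bornology.cobounded ℂ) := by
      have h3 := (tendsto_const_add_cobounded b).comp h1
      have h4 := (tendsto_pow_cobounded_cobounded two_ne_zero).comp h3
      exact (tendsto_const_add_cobounded a).comp h4
    have h3 : Tendsto ((↑) : ℂ → OnePoint ℂ) (Bornology.cobounded ℂ) (𝓝 OnePoint.infty) := by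
      rw [Metric.cobounded_eq_cocompact, ← coclosedCompact_eq_cocompact]
      exact OnePoint.tendsto_coe_infty
    have h4 : sphereQuad a b 0 = OnePoint.infty := if_pos rfl
    rw [h4]
    refine (h3.comp h2).congr' ?_
    filter_upwards [self_mem_nhdsWithin] with v hv
    exact (sphereQuad_of_ne hv).symm
  · have h1 : ContinuousAt (fun u : ℂ => ((a + (b + u⁻¹) ^ 2 : ℂ) : OnePoint ℂ)) u := by
      refine OnePoint.continuous_coe.continuousAt.comp ?_
      fun_prop (disch := exact hu)
    refine h1.congr ?_
    filter_upwards [isOpen_ne.mem_nhds hu] with v hv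
    exact (sphereQuad_of_ne hv).symm

/-- Finiteness is what lets an end point on the sphere be avoided by avoiding finitely many values
of the bounded factor. -/
theorem finite_sphereQuad_fiber (a b u : ℂ) : {v | sphereQuad a b v = sphereQuad a b u}.Finite := by
  refine (Set.toFinite {0, u, (-(2 * b + u⁻¹))⁻¹}).subset fun v hv => ?_
  simp only [mem_ofPred_eq] at hv
  simp only [mem_insert_iff, mem_singleton_iff]
  by_cases hv0 : v = 0
  · exact Or.inl hv0
  by_cases hu0 : u = 0
  · rw [sphereQuad_of_ne hv0, sphereQuad, if_pos hu0] at hv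
    exact absurd hv (OnePoint.coe_ne_infty _)
  · rw [sphereQuad_of_ne hv0, sphereQuad_of_ne hu0, OnePoint.coe_eq_coe, add_right_inj,
      sq_eq_sq_iff_eq_or_eq_neg] at hv
    rcases hv with hv | hv
    · exact Or.inr (Or.inl (by simpa using hv))
    · refine Or.inr (Or.inr ?_)
      rw [← inv_inj, inv_inv]
      linear_combination hv

/-- Points of the plane that are bounded and close have close images in the sphere. -/
theorem exists_chordalDist_lt_of_sphereQuad (a b : ℂ) (M : ℝ) {ε : ℝ} (hε : 0 < ε) :
    ∃ δ > 0, ∀ u v x y : ℂ, ‖u‖ ≤ M → ‖v‖ ≤ M → dist u v < δ → sphereQuad a b u = x →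
      sphereQuad a b v = y → chordalDist x y < ε := by
  have hc : Continuous fun u => sphereCoord (sphereQuad a b u) :=
    continuous_sphereCoord.comp (continuous_sphereQuad a b)
  have hu := (isCompact_closedBall (0 : ℂ) M).uniformContinuousOn_of_continuous hc.continuousOn
  obtain ⟨δ, hδ, h⟩ := Metric.uniformContinuousOn_iff.1 hu (ε / 2) (half_pos hε)
  refine ⟨δ, hδ, fun u v x y hu hv huv hx hy => ?_⟩
  have := h u (by simpa using hu) v (by simpa using hv) huv
  rw [hx, hy] at this
  have := chordalDist_le x y
  linarith

/-! ### Topology of crosscuts and null-chains -/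

theorem isPreconnected_of_toSphere {A : Set ℂ} (h : IsPreconnected (toSphere A)) :
    IsPreconnected A :=
  OnePoint.isOpenEmbedding_coe.isInducing.isPreconnected_image.1 h

theorem isOpen_toSphere {Ω : Set ℂ} (hΩ : IsOpen Ω) : IsOpen (toSphere Ω) :=
  OnePoint.isOpenMap_coe _ hΩ

theorem coe_mem_toSphere {A : Set ℂ} {z : ℂ} : (z : OnePoint ℂ) ∈ toSphere A ↔ z ∈ A :=
  OnePoint.coe_injective.mem_set_image

theorem IsCrosscut.nonempty {Ω C : Set ℂ} (h : IsCrosscut Ω C) : C.Nonempty := by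
  obtain ⟨-, γ, -, -, hC, -⟩ := h
  have : (toSphere C).Nonempty := hC ▸ (nonempty_Ioo.2 zero_lt_one).image γ
  exact image_nonempty.1 this

theorem IsCrosscut.isPreconnected {Ω C : Set ℂ} (h : IsCrosscut Ω C) : IsPreconnected C := by
  obtain ⟨-, γ, hγ, -, hC, -⟩ := h
  refine isPreconnected_of_toSphere ?_
  rw [← hC]
  exact isPreconnected_Ioo.image γ (hγ.mono Ioo_subset_Icc_self)

/-- A crosscut has a boundary point of the domain in its closure. -/
theorem IsCrosscut.exists_mem_frontier {Ω C : Set ℂ} (h : IsCrosscut Ω C) :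
    ∃ e ∈ frontier (toSphere Ω), e ∈ closure (toSphere C) := by
  obtain ⟨-, γ, hγ, -, hC, h0, -⟩ := h
  refine ⟨γ 0, h0, ?_⟩
  rw [← hC]
  have h1 : (0 : ℝ) ∈ closure (Ioo (0 : ℝ) 1) := by rw [closure_Ioo zero_ne_one]; simp
  exact ((hγ 0 (by simp)).mono Ioo_subset_Icc_self).mem_closure_image h1

namespace NullChain

variable {Ω : Set ℂ}

/-- The crosscuts of a null-chain leave every compact subset of the domain. -/
theorem eventually_disjoint_compact (C : NullChain Ω) (hΩ : IsOpen Ω) {K : Set ℂ}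
    (hK : IsCompact K) (hKΩ : K ⊆ Ω) : ∀ᶠ n in atTop, Disjoint K (C.cut n) := by
  have hdisj : Disjoint (toSphere K) (frontier (toSphere Ω)) := by
    rw [(isOpen_toSphere hΩ).frontier_eq]
    exact disjoint_sdiff_self_right.mono_left (image_mono hKΩ)
  obtain ⟨ε, hε, hgap⟩ := exists_chordalDist_gap
    (hK.image OnePoint.continuous_coe).isClosed isClosed_frontier hdisj
  filter_upwards [C.diam_tendsto_zero (ε / 2) (half_pos hε)] with n hn
  rw [Set.disjoint_left]
  intro z hzK hzC
  obtain ⟨e, he, heC⟩ := (C.isCrosscut n).exists_mem_frontier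
  -- A crosscut through z has a boundary point in its closure; if its diameter is below ε/2, that
  -- point is within ε/2 of z, against the gap ε between K and the boundary.
  have hcl : IsClosed {p : OnePoint ℂ | dist (sphereCoord z) (sphereCoord p) ≤ ε / 2} :=
    isClosed_le (continuous_const.dist continuous_sphereCoord) continuous_const
  have hsub : toSphere (C.cut n) ⊆ {p | dist (sphereCoord z) (sphereCoord p) ≤ ε / 2} := by
    rintro _ ⟨w, hw, rfl⟩
    exact (dist_sphereCoord_le z w).trans (hn z hzC w hw).le
  have h1 : dist (sphereCoord z) (sphereCoord e) ≤ ε / 2 := closure_minimal hsub hcl heC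
  have h2 := hgap z (mem_image_of_mem _ hzK) e he
  linarith

/-- Such a set stays in the component of its point of C₀. Together with the next lemma, which holds
because an interior part is a union of components, this is how sides of a crosscut are told apart
below. -/
theorem disjoint_interiorPart (C : NullChain Ω) {n : ℕ} {A : Set ℂ} (hA : IsPreconnected A)
    (hAC : A ⊆ Ω \ C.cut n) {c : ℂ} (hc : c ∈ C.cut 0) (hcA : c ∈ A) :
    Disjoint A (C.interiorPart n) := by
  rw [Set.disjoint_left]
  intro x hx hxi
  exact hxi.2 c hc (hA.subset_connectedComponentIn hcA hAC hx)

theorem subset_interiorPart (C : NullChain Ω) {n : ℕ} {A : Set ℂ} (hA : IsPreconnected A)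
    (hAC : A ⊆ Ω \ C.cut n) {x : ℂ} (hx : x ∈ C.interiorPart n) (hxA : x ∈ A) :
    A ⊆ C.interiorPart n := by
  refine fun y hy => ⟨hAC hy, fun a ha hya => hx.2 a ha ?_⟩
  rw [connectedComponentIn_eq hya]
  exact hA.subset_connectedComponentIn hy hAC hxA

end NullChain

/-! ### Vertical lines of the strip and uniqueness of the prime end -/

/-- The strip of width `π` around the real axis. -/
def horizontalStrip : Set ℂ := Complex.im ⁻¹' Ioo (-(Real.pi / 2)) (Real.pi / 2)

theorem isOpen_horizontalStrip : IsOpen horizontalStrip := isOpen_Ioo.preimage Complex.continuous_im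

theorem convex_horizontalStrip : Convex ℝ horizontalStrip :=
  (convex_Ioo _ _).linear_preimage Complex.imLm

theorem ofReal_mem_horizontalStrip (t : ℝ) : (t : ℂ) ∈ horizontalStrip := by
  simp [horizontalStrip, Real.pi_pos]

/-- The image of the part of the strip over a set of abscissas. -/
def stripImage (G : ℂ → ℂ) (I : Set ℝ) : Set ℂ := G '' (horizontalStrip ∩ Complex.re ⁻¹' I)

section strip

variable {G : ℂ → ℂ}

theorem mem_stripImage (hinj : InjOn G horizontalStrip) {I : Set ℝ} {ζ : ℂ}
    (hζ : ζ ∈ horizontalStrip) : G ζ ∈ stripImage G I ↔ ζ.re ∈ I := by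
  constructor
  · rintro ⟨ξ, ⟨hξ, hI⟩, h⟩
    rwa [← hinj hξ hζ h]
  · exact fun h => ⟨ζ, ⟨hζ, h⟩, rfl⟩

theorem stripImage_subset (I : Set ℝ) : stripImage G I ⊆ G '' horizontalStrip :=
  image_mono inter_subset_left

theorem disjoint_stripImage (hinj : InjOn G horizontalStrip) {I J : Set ℝ} (h : Disjoint I J) :
    Disjoint (stripImage G I) (stripImage G J) := by
  rw [Set.disjoint_left]
  rintro _ ⟨ζ, ⟨hζ, hI⟩, rfl⟩ hJ
  exact Set.disjoint_left.1 h hI ((mem_stripImage hinj hζ).1 hJ)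

theorem isPreconnected_stripImage (hG : ContinuousOn G horizontalStrip) {I : Set ℝ}
    (hI : Convex ℝ I) : IsPreconnected (stripImage G I) :=
  (convex_horizontalStrip.inter (hI.linear_preimage Complex.reLm)).isPreconnected.image _
    (hG.mono inter_subset_left)

theorem isOpen_stripImage (hG : DifferentiableOn ℂ G horizontalStrip)
    (hinj : InjOn G horizontalStrip) {I : Set ℝ} (hI : IsOpen I) : IsOpen (stripImage G I) :=
  isOpen_image_of_injOn isOpen_horizontalStrip convex_horizontalStrip.isPreconnected hG hinj
    inter_subset_left (isOpen_horizontalStrip.inter (hI.preimage Complex.continuous_re))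

theorem stripImage_subset_diff (hinj : InjOn G horizontalStrip) {I J : Set ℝ} (h : Disjoint I J) :
    stripImage G I ⊆ G '' horizontalStrip \ stripImage G J :=
  subset_sdiff.2 ⟨stripImage_subset I, disjoint_stripImage hinj h⟩

/-- A connected set off a vertical line of the strip lies on one side of it. -/
theorem stripImage_dichotomy (hG : DifferentiableOn ℂ G horizontalStrip)
    (hinj : InjOn G horizontalStrip) {A : Set ℂ} (hA : IsPreconnected A) {t : ℝ}
    (hAt : A ⊆ G '' horizontalStrip \ stripImage G {t}) :
    A ⊆ stripImage G (Iio t) ∨ A ⊆ stripImage G (Ioi t) := by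
  have hcov : A ⊆ stripImage G (Iio t) ∪ stripImage G (Ioi t) := by
    intro x hx
    obtain ⟨⟨ζ, hζ, rfl⟩, hxt⟩ := hAt hx
    rw [mem_stripImage hinj hζ] at hxt
    rcases lt_or_gt_of_ne hxt with h | h
    · exact Or.inl ((mem_stripImage hinj hζ).2 h)
    · exact Or.inr ((mem_stripImage hinj hζ).2 h)
  have hdisj : Disjoint (stripImage G (Iio t)) (stripImage G (Ioi t)) :=
    disjoint_stripImage hinj (Iio_disjoint_Ioi_of_le le_rfl)
  rcases A.eq_empty_or_nonempty with rfl | ⟨a, ha⟩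
  · simp
  · rcases hcov ha with h | h
    · exact Or.inl (hA.subset_left_of_subset_union (isOpen_stripImage hG hinj isOpen_Iio)
        (isOpen_stripImage hG hinj isOpen_Ioi) hdisj hcov ⟨a, ha, h⟩)
    · exact Or.inr (hA.subset_right_of_subset_union (isOpen_stripImage hG hinj isOpen_Iio)
        (isOpen_stripImage hG hinj isOpen_Ioi) hdisj hcov ⟨a, ha, h⟩)

/-- The left half is connected, and by the dichotomy a connected set that meets it cannot reach the
other side. -/
theorem connectedComponentIn_stripImage (hG : DifferentiableOn ℂ G horizontalStrip)
    (hinj : InjOn G horizontalStrip) {s t : ℝ} (hst : s < t) {a : ℂ} (ha : a ∈ stripImage G {s}) :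
    connectedComponentIn (G '' horizontalStrip \ stripImage G {t}) a = stripImage G (Iio t) := by
  have hat : a ∈ stripImage G (Iio t) := image_mono (by gcongr; simpa using hst) ha
  have hlow : stripImage G (Iio t) ⊆ G '' horizontalStrip \ stripImage G {t} :=
    stripImage_subset_diff hinj (by simp)
  refine Subset.antisymm ?_
    ((isPreconnected_stripImage hG.continuousOn (convex_Iio t)).subset_connectedComponentIn hat hlow)
  rcases stripImage_dichotomy hG hinj (isPreconnected_connectedComponentIn (x := a))
    (connectedComponentIn_subset _ _) with h | h
  · exact h
  · exact absurd (h (mem_connectedComponentIn (hlow hat)))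
      (Set.disjoint_left.1 (disjoint_stripImage hinj (Iio_disjoint_Ioi_of_le le_rfl)) hat)

theorem separates_stripImage (hG : DifferentiableOn ℂ G horizontalStrip)
    (hinj : InjOn G horizontalStrip) {r s t : ℝ} (hrs : r < s) (hst : s < t) :
    Separates (G '' horizontalStrip) (stripImage G {s}) (stripImage G {r}) (stripImage G {t}) := by
  refine ⟨stripImage_subset_diff hinj (by simpa using hrs.ne),
    stripImage_subset_diff hinj (by simpa using hst.ne'), fun a ha b hb hba => ?_⟩
  rw [connectedComponentIn_stripImage hG hinj hrs ha] at hba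
  refine Set.disjoint_left.1 (disjoint_stripImage hinj ?_) hb hba
  simpa using hst.le

theorem interiorPart_of_cut_eq (hG : DifferentiableOn ℂ G horizontalStrip)
    (hinj : InjOn G horizontalStrip) {V : NullChain (G '' horizontalStrip)} {t : ℕ → ℝ}
    (ht : StrictMono t) (hV : ∀ n, V.cut n = stripImage G {t n}) {n : ℕ} (hn : 1 ≤ n) :
    V.interiorPart n = stripImage G (Ioi (t n)) := by
  have h0n : t 0 < t n := ht hn
  have h0 : G (t 0) ∈ stripImage G {t 0} :=
    (mem_stripImage hinj (ofReal_mem_horizontalStrip _)).2 (by simp)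
  ext x
  simp only [NullChain.interiorPart, hV, mem_ofPred_eq]
  constructor
  · rintro ⟨⟨⟨ζ, hζ, rfl⟩, hxt⟩, hxa⟩
    have h1 := hxa _ h0
    rw [connectedComponentIn_stripImage hG hinj h0n h0, mem_stripImage hinj hζ] at h1
    rw [mem_stripImage hinj hζ] at hxt ⊢
    exact lt_of_le_of_ne (not_lt.1 h1) (Ne.symm hxt)
  · intro hx
    refine ⟨stripImage_subset_diff hinj (by simp) hx, fun a ha => ?_⟩
    rw [connectedComponentIn_stripImage hG hinj h0n ha]
    exact Set.disjoint_left.1 (disjoint_stripImage hinj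
      (Ioi_disjoint_Iio_of_le le_rfl)) hx

/-- A null-chain all of whose interior parts are neighbourhoods of the right end of the strip is
equivalent to every null-chain of vertical lines going to the right end. -/
theorem equivalent_of_right_end (hG : DifferentiableOn ℂ G horizontalStrip)
    (hinj : InjOn G horizontalStrip) {V : NullChain (G '' horizontalStrip)} {t : ℕ → ℝ}
    (ht : StrictMono t) (htop : Tendsto t atTop atTop) (hV : ∀ n, V.cut n = stripImage G {t n})
    (C : NullChain (G '' horizontalStrip))
    (hC : ∀ n, 1 ≤ n → ∃ T : ℝ, stripImage G (Ioi T) ⊆ C.interiorPart n) :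
    C.Equivalent V := by
  have hΩ : IsOpen (G '' horizontalStrip) :=
    isOpen_image_of_injOn isOpen_horizontalStrip convex_horizontalStrip.isPreconnected hG hinj
      Subset.rfl isOpen_horizontalStrip
  refine ⟨fun m hm => ?_, fun m hm => ?_⟩
  · obtain ⟨T, hT⟩ := hC m hm
    obtain ⟨n, hn1, hnT⟩ := ((eventually_ge_atTop 1).and (htop.eventually_ge_atTop T)).exists
    refine ⟨n, hn1, ?_⟩
    rw [interiorPart_of_cut_eq hG hinj ht hV hn1]
    exact (image_mono (inter_subset_inter_right _ (preimage_mono (Ioi_subset_Ioi hnT)))).trans hT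
  · obtain ⟨c, hc⟩ := (C.isCrosscut 0).nonempty
    obtain ⟨ξ, hξ, rfl⟩ := (C.isCrosscut 0).1 hc
    -- Both lines `t N` and `t (N + 1)` lie to the right of ξ and not to the left of `t m`. A
    -- crosscut shorter than the gap between them misses one of the two.
    obtain ⟨N, hmN, hξN⟩ := ((eventually_ge_atTop m).and (htop.eventually_gt_atTop ξ.re)).exists
    obtain ⟨ε, hε, hgap⟩ := exists_chordalDist_gap isClosed_closure isClosed_closure
      (V.disjoint_closure N)
    -- K joins a point of C₀ to the line `t (N + 1)`. Late crosscuts miss it, so it lies outside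
    -- their interior parts.
    let K : Set ℂ := G '' segment ℝ ξ (t (N + 1) : ℝ)
    have hseg : segment ℝ ξ (t (N + 1) : ℝ) ⊆ horizontalStrip :=
      convex_horizontalStrip.segment_subset hξ (ofReal_mem_horizontalStrip _)
    have hKΩ : K ⊆ G '' horizontalStrip := image_mono hseg
    have hKc : IsCompact K := by
      have : IsCompact (segment ℝ ξ (t (N + 1) : ℝ)) := by
        rw [segment_eq_image]
        exact isCompact_Icc.image (by fun_prop)
      exact this.image_of_continuousOn (hG.continuousOn.mono hseg)
    have hKp : IsPreconnected K :=
      (convex_segment _ _).isPreconnected.image _ (hG.continuousOn.mono hseg)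
    obtain ⟨n, hn1, hnd, hnK⟩ := ((eventually_ge_atTop 1).and
      ((C.diam_tendsto_zero ε hε).and (C.eventually_disjoint_compact hΩ hKc hKΩ))).exists
    have hKint : Disjoint K (C.interiorPart n) :=
      C.disjoint_interiorPart hKp (subset_sdiff.2 ⟨hKΩ, hnK⟩) hc ⟨ξ, left_mem_segment _ _ _, rfl⟩
    refine ⟨n, hn1, ?_⟩
    obtain ⟨T, hTm, hTN, hTξ, hTC⟩ : ∃ T, t m ≤ T ∧ T ≤ t (N + 1) ∧ ξ.re < T ∧
        Disjoint (C.cut n) (stripImage G {T}) := by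
      by_cases h : Disjoint (C.cut n) (stripImage G {t N})
      · exact ⟨t N, ht.monotone hmN, ht.monotone (Nat.le_succ N), hξN, h⟩
      · refine ⟨t (N + 1), ht.monotone (hmN.trans (Nat.le_succ N)), le_rfl,
          hξN.trans (ht (Nat.lt_succ_self N)), ?_⟩
        obtain ⟨x, hxC, hxN⟩ := Set.not_disjoint_iff.1 h
        rw [Set.disjoint_left]
        intro y hyC hyN
        have h1 := hgap x (subset_closure (coe_mem_toSphere.2 (by rwa [hV])))
          y (subset_closure (coe_mem_toSphere.2 (by rwa [hV])))
        have h2 := dist_sphereCoord_le x y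
        have h3 := hnd x hxC y hyC
        linarith
    have hsub := subset_sdiff.2 ⟨(C.isCrosscut n).1, hTC⟩
    rw [interiorPart_of_cut_eq hG hinj ht hV hm]
    rcases stripImage_dichotomy hG hinj (C.isCrosscut n).isPreconnected hsub with h | h
    -- If the crosscut were left of T, the closed right part would be connected in its complement
    -- and contain points of the interior part, hence lie inside it. But it contains the right end
    -- of K.
    · exfalso
      have hA : stripImage G (Ici T) ⊆ G '' horizontalStrip \ C.cut n :=
        subset_sdiff.2 ⟨stripImage_subset _,
          (disjoint_stripImage hinj (by simp)).mono_right h⟩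
      obtain ⟨T', hT'⟩ := hC n hn1
      set x : ℝ := max T T' + 1
      have hx1 : T ≤ x := (le_max_left T T').trans (by simp [x])
      have hx2 : T' < x := (le_max_right T T').trans_lt (by simp [x])
      have hx : G x ∈ stripImage G (Ici T) :=
        (mem_stripImage hinj (ofReal_mem_horizontalStrip _)).2 (by simpa using hx1)
      have hx' : G x ∈ C.interiorPart n :=
        hT' ((mem_stripImage hinj (ofReal_mem_horizontalStrip _)).2 (by simpa using hx2))
      have h2 := C.subset_interiorPart
        (isPreconnected_stripImage hG.continuousOn (convex_Ici T)) hA hx' hx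
      have h3 : G (t (N + 1) : ℝ) ∈ stripImage G (Ici T) :=
        (mem_stripImage hinj (ofReal_mem_horizontalStrip _)).2 (by simpa using hTN)
      exact Set.disjoint_left.1 hKint ⟨_, right_mem_segment _ _ _, rfl⟩ (h2 h3)
    -- Now the closed left part is connected off the crosscut and contains a point of C₀, so the
    -- interior part lies to the right of T.
    · have hA : stripImage G (Iic T) ⊆ G '' horizontalStrip \ C.cut n :=
        subset_sdiff.2 ⟨stripImage_subset _,
          (disjoint_stripImage hinj (by simp)).mono_right h⟩
      have h2 := C.disjoint_interiorPart
        (isPreconnected_stripImage hG.continuousOn (convex_Iic T)) hA hc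
        ((mem_stripImage hinj hξ).2 hTξ.le)
      rintro x hx
      obtain ⟨ζ, hζ, rfl⟩ := hx.1.1
      rw [mem_stripImage hinj hζ]
      by_contra! hle
      exact Set.disjoint_left.1 h2 ((mem_stripImage hinj hζ).2
        ((not_lt.1 hle).trans hTm : ζ.re ≤ T)) hx

end strip

/-! ### Crossing of late crosscuts by the real axis -/

section crossing

variable {G : ℂ → ℂ}

/-- The real axis crosses the late crosscuts of a null-chain at the right end, far away. -/
theorem eventually_exists_real_mem_cut (hG : DifferentiableOn ℂ G horizontalStrip)
    (hinj : InjOn G horizontalStrip) (C : NullChain (G '' horizontalStrip))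
    (hC : ∀ n, 1 ≤ n → ∃ T : ℝ, stripImage G (Ioi T) ⊆ C.interiorPart n) (R : ℝ) :
    ∀ᶠ n in atTop, ∃ s : ℝ, R ≤ s ∧ G s ∈ C.cut n := by
  have hΩ : IsOpen (G '' horizontalStrip) :=
    isOpen_image_of_injOn isOpen_horizontalStrip convex_horizontalStrip.isPreconnected hG hinj
      Subset.rfl isOpen_horizontalStrip
  obtain ⟨c, hc⟩ := (C.isCrosscut 0).nonempty
  obtain ⟨ξ, hξ, rfl⟩ := (C.isCrosscut 0).1 hc
  have hseg : segment ℝ ξ (R : ℂ) ⊆ horizontalStrip :=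
    convex_horizontalStrip.segment_subset hξ (ofReal_mem_horizontalStrip _)
  have hKΩ : G '' segment ℝ ξ (R : ℂ) ⊆ G '' horizontalStrip := image_mono hseg
  have hKc : IsCompact (G '' segment ℝ ξ (R : ℂ)) := by
    have : IsCompact (segment ℝ ξ (R : ℂ)) := by
      rw [segment_eq_image]
      exact isCompact_Icc.image (by fun_prop)
    exact this.image_of_continuousOn (hG.continuousOn.mono hseg)
  have hKp : IsPreconnected (G '' segment ℝ ξ (R : ℂ)) :=
    (convex_segment _ _).isPreconnected.image _ (hG.continuousOn.mono hseg)
  filter_upwards [eventually_ge_atTop 1, C.eventually_disjoint_compact hΩ hKc hKΩ] with n hn hnK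
  have hKint : Disjoint (G '' segment ℝ ξ (R : ℂ)) (C.interiorPart n) :=
    C.disjoint_interiorPart hKp (subset_sdiff.2 ⟨hKΩ, hnK⟩) hc ⟨ξ, left_mem_segment _ _ _, rfl⟩
  -- A ray from R that missed the crosscut would lie in its interior part, because its far points
  -- do. Its starting point is joined to C₀ off the crosscut, a contradiction.
  by_contra! hno
  have hmem : ∀ s : ℝ, (s : ℂ) ∈ horizontalStrip := ofReal_mem_horizontalStrip
  have hray : IsPreconnected ((fun s : ℝ => G s) '' Ici R) :=
    (convex_Ici R).isPreconnected.image _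
      (hG.continuousOn.comp Complex.continuous_ofReal.continuousOn fun s _ => hmem s)
  have hsub : (fun s : ℝ => G s) '' Ici R ⊆ G '' horizontalStrip \ C.cut n := by
    rintro _ ⟨s, hs, rfl⟩
    exact ⟨⟨s, hmem s, rfl⟩, hno s hs⟩
  obtain ⟨T, hT⟩ := hC n hn
  have hx : G (max R T + 1 : ℝ) ∈ C.interiorPart n :=
    hT ((mem_stripImage hinj (hmem _)).2 (by
      rw [Complex.ofReal_re, mem_Ioi]; linarith [le_max_right R T]))
  have h1 := C.subset_interiorPart hray hsub hx
    ⟨max R T + 1, by rw [mem_Ici]; linarith [le_max_left R T], rfl⟩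
  exact Set.disjoint_left.1 hKint ⟨_, right_mem_segment _ _ _, rfl⟩ (h1 ⟨R, self_mem_Ici, rfl⟩)

/-- The diameters tend to zero, so the chosen point of a crosscut can be replaced by its crossing
with the real axis without changing the limit. -/
theorem exists_real_tendsto_of_mem_cut (hG : DifferentiableOn ℂ G horizontalStrip)
    (hinj : InjOn G horizontalStrip) (C : NullChain (G '' horizontalStrip))
    (hC : ∀ n, 1 ≤ n → ∃ T : ℝ, stripImage G (Ioi T) ⊆ C.interiorPart n)
    {x : ℕ → ℂ} (hx : ∀ n, x n ∈ C.cut n) {p : OnePoint ℂ}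
    (hxp : Tendsto (fun n => (x n : OnePoint ℂ)) atTop (𝓝 p)) :
    ∃ s : ℕ → ℝ, Tendsto s atTop atTop ∧
      Tendsto (fun n => (G (s n) : OnePoint ℂ)) atTop (𝓝 p) := by
  have h : ∀ k : ℕ, ∃ n : ℕ, k ≤ n ∧ ∃ s : ℝ, (k : ℝ) ≤ s ∧ G s ∈ C.cut n := fun k =>
    ((eventually_ge_atTop k).and (eventually_exists_real_mem_cut hG hinj C hC k)).exists
  choose n hkn s hks hs using h
  have hn : Tendsto n atTop atTop := tendsto_atTop_mono hkn tendsto_id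
  refine ⟨s, tendsto_atTop_mono hks tendsto_natCast_atTop_atTop, ?_⟩
  refine tendsto_sphere_of_chordalDist (hxp.comp hn) ?_
  rw [Metric.tendsto_atTop']
  intro ε hε
  obtain ⟨N, hN⟩ := eventually_atTop.1 (hn.eventually (C.diam_tendsto_zero ε hε))
  refine ⟨N, fun k hk => ?_⟩
  rw [Real.dist_0_eq_abs, abs_of_nonneg (chordalDist_nonneg _ _)]
  exact hN k hk.le _ (hx _) _ (hs k)

end crossing

/-! ### The conformal map between strip and disc -/

/-- The conformal map `ζ ↦ σ * tanh (ζ / 2)` of the strip onto the unit disc; the right end of the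
strip corresponds to the boundary point `σ`. -/
noncomputable def stripToDisc (σ ζ : ℂ) : ℂ := σ * ((Complex.exp ζ - 1) / (Complex.exp ζ + 1))

theorem re_exp_pos {ζ : ℂ} (hζ : ζ ∈ horizontalStrip) : 0 < (Complex.exp ζ).re := by
  rw [Complex.exp_re]
  exact mul_pos (Real.exp_pos _) (Real.cos_pos_of_mem_Ioo hζ)

theorem normSq_exp_add_one (ζ : ℂ) : ‖Complex.exp ζ + 1‖ ^ 2 =
    Real.exp ζ.re ^ 2 + 2 * (Complex.exp ζ).re + 1 := by
  rw [← Complex.norm_exp, ← Complex.normSq_eq_norm_sq, ← Complex.normSq_eq_norm_sq,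
    Complex.normSq_apply, Complex.normSq_apply]
  simp
  ring

theorem normSq_exp_sub_one (ζ : ℂ) : ‖Complex.exp ζ - 1‖ ^ 2 =
    Real.exp ζ.re ^ 2 - 2 * (Complex.exp ζ).re + 1 := by
  rw [← Complex.norm_exp, ← Complex.normSq_eq_norm_sq, ← Complex.normSq_eq_norm_sq,
    Complex.normSq_apply, Complex.normSq_apply]
  simp
  ring

theorem exp_le_norm_exp_add_one {ζ : ℂ} (hζ : ζ ∈ horizontalStrip) :
    Real.exp ζ.re ≤ ‖Complex.exp ζ + 1‖ := by
  refine le_of_sq_le_sq ?_ (norm_nonneg _)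
  rw [normSq_exp_add_one]
  linarith [re_exp_pos hζ]

theorem norm_exp_add_one_le (ζ : ℂ) : ‖Complex.exp ζ + 1‖ ≤ Real.exp ζ.re + 1 := by
  simpa [Complex.norm_exp] using norm_add_le (Complex.exp ζ) 1

theorem norm_exp_add_one_pos {ζ : ℂ} (hζ : ζ ∈ horizontalStrip) : 0 < ‖Complex.exp ζ + 1‖ :=
  (Real.exp_pos _).trans_le (exp_le_norm_exp_add_one hζ)

theorem exp_add_one_ne_zero {ζ : ℂ} (hζ : ζ ∈ horizontalStrip) : Complex.exp ζ + 1 ≠ 0 :=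
  norm_pos_iff.1 (norm_exp_add_one_pos hζ)

section

variable {σ : ℂ}

theorem norm_stripToDisc (hσ : ‖σ‖ = 1) (ζ : ℂ) :
    ‖stripToDisc σ ζ‖ = ‖Complex.exp ζ - 1‖ / ‖Complex.exp ζ + 1‖ := by
  rw [stripToDisc, norm_mul, hσ, one_mul, norm_div]

theorem one_sub_norm_stripToDisc_sq (hσ : ‖σ‖ = 1) {ζ : ℂ} (hζ : ζ ∈ horizontalStrip) :
    1 - ‖stripToDisc σ ζ‖ ^ 2 = 4 * (Complex.exp ζ).re / ‖Complex.exp ζ + 1‖ ^ 2 := by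
  have := (norm_exp_add_one_pos hζ).ne'
  rw [norm_stripToDisc hσ, div_pow, eq_div_iff (by positivity), sub_mul, div_mul_cancel₀ _
    (by positivity), normSq_exp_add_one, normSq_exp_sub_one]
  ring

theorem stripToDisc_mem_ball (hσ : ‖σ‖ = 1) {ζ : ℂ} (hζ : ζ ∈ horizontalStrip) :
    stripToDisc σ ζ ∈ ball (0 : ℂ) 1 := by
  rw [mem_ball_zero_iff]
  have h1 := one_sub_norm_stripToDisc_sq hσ hζ
  have h2 : 0 < 4 * (Complex.exp ζ).re / ‖Complex.exp ζ + 1‖ ^ 2 := by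
    have := re_exp_pos hζ
    have := norm_exp_add_one_pos hζ
    positivity
  nlinarith [norm_nonneg (stripToDisc σ ζ)]

theorem dist_stripToDisc (hσ : ‖σ‖ = 1) {ζ : ℂ} (hζ : ζ ∈ horizontalStrip) :
    ‖σ - stripToDisc σ ζ‖ = 2 / ‖Complex.exp ζ + 1‖ := by
  have h : σ - stripToDisc σ ζ = σ * (2 / (Complex.exp ζ + 1)) := by
    have h1 := exp_add_one_ne_zero hζ
    have h2 : (Complex.exp ζ - 1) / (Complex.exp ζ + 1) = 1 - 2 / (Complex.exp ζ + 1) := by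
      rw [eq_sub_iff_add_eq, ← add_div, div_eq_one_iff_eq h1]
      ring
    rw [stripToDisc, h2]
    ring
  rw [h, norm_mul, hσ, one_mul, norm_div, Complex.norm_ofNat]

theorem differentiableOn_stripToDisc (σ : ℂ) :
    DifferentiableOn ℂ (stripToDisc σ) horizontalStrip := by
  intro ζ hζ
  have he : DifferentiableAt ℂ Complex.exp ζ := Complex.differentiable_exp ζ
  exact (((he.sub_const 1).div (he.add_const 1)
    (exp_add_one_ne_zero hζ)).const_mul σ).differentiableWithinAt

theorem injOn_stripToDisc (hσ : ‖σ‖ = 1) : InjOn (stripToDisc σ) horizontalStrip := by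
  have hσ0 : σ ≠ 0 := norm_ne_zero_iff.1 (by rw [hσ]; exact one_ne_zero)
  intro ζ hζ ξ hξ h
  have h1 := exp_add_one_ne_zero hζ
  have h2 := exp_add_one_ne_zero hξ
  have h3 : Complex.exp ζ = Complex.exp ξ := by
    have := mul_left_cancel₀ hσ0 h
    rw [div_eq_div_iff h1 h2] at this
    linear_combination this / 2
  have hpi := Real.pi_pos
  rw [← Complex.log_exp (x := ζ) (by linarith [hζ.1]) (by linarith [hζ.2]), h3,
    Complex.log_exp (by linarith [hξ.1]) (by linarith [hξ.2])]

/-- The inverse of `stripToDisc`. -/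
noncomputable def discToStrip (σ z : ℂ) : ℂ := Complex.log ((σ + z) / (σ - z))

theorem sub_ne_zero_of_mem_ball (hσ : ‖σ‖ = 1) {z : ℂ} (hz : z ∈ ball (0 : ℂ) 1) : σ - z ≠ 0 := by
  intro h
  rw [mem_ball_zero_iff, ← sub_eq_zero.1 h, hσ] at hz
  exact lt_irrefl _ hz

theorem add_ne_zero_of_mem_ball (hσ : ‖σ‖ = 1) {z : ℂ} (hz : z ∈ ball (0 : ℂ) 1) : σ + z ≠ 0 := by
  have := sub_ne_zero_of_mem_ball hσ (z := -z) (by simpa using hz)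
  simpa using this

theorem discToStrip_mem (hσ : ‖σ‖ = 1) {z : ℂ} (hz : z ∈ ball (0 : ℂ) 1) :
    discToStrip σ z ∈ horizontalStrip := by
  have h1 := sub_ne_zero_of_mem_ball hσ hz
  have hre : 0 < ((σ + z) / (σ - z)).re := by
    rw [Complex.div_re, ← add_div]
    refine div_pos ?_ (Complex.normSq_pos.2 h1)
    have h2 : ‖σ‖ ^ 2 = 1 := by rw [hσ]; norm_num
    have h3 : ‖z‖ ^ 2 < 1 := by
      rw [mem_ball_zero_iff] at hz
      nlinarith [norm_nonneg z]
    rw [← Complex.normSq_eq_norm_sq, Complex.normSq_apply] at h2 h3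
    simp only [Complex.add_re, Complex.add_im, Complex.sub_re, Complex.sub_im]
    nlinarith
  have := abs_lt.1 (Complex.abs_arg_lt_pi_div_two_iff.2 (Or.inl hre))
  simpa [horizontalStrip, discToStrip, Complex.log_im] using this

theorem stripToDisc_discToStrip (hσ : ‖σ‖ = 1) {z : ℂ} (hz : z ∈ ball (0 : ℂ) 1) :
    stripToDisc σ (discToStrip σ z) = z := by
  have h1 := sub_ne_zero_of_mem_ball hσ hz
  have h2 := add_ne_zero_of_mem_ball hσ hz
  have hσ0 : σ ≠ 0 := norm_ne_zero_iff.1 (by rw [hσ]; exact one_ne_zero)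
  rw [stripToDisc, discToStrip, Complex.exp_log (div_ne_zero h2 h1)]
  have h3 : (σ + z) / (σ - z) + 1 = 2 * σ / (σ - z) := by field_simp; ring
  have h4 : (σ + z) / (σ - z) - 1 = 2 * z / (σ - z) := by field_simp; ring
  rw [h3, h4]
  field_simp

theorem image_stripToDisc (hσ : ‖σ‖ = 1) :
    stripToDisc σ '' horizontalStrip = ball (0 : ℂ) 1 := by
  refine Subset.antisymm (image_subset_iff.2 fun ζ hζ => stripToDisc_mem_ball hσ hζ) fun z hz => ?_
  exact ⟨_, discToStrip_mem hσ hz, stripToDisc_discToStrip hσ hz⟩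

theorem exp_re_le (hσ : ‖σ‖ = 1) {ζ : ℂ} (hζ : ζ ∈ horizontalStrip) :
    Real.exp ζ.re * ‖σ - stripToDisc σ ζ‖ ≤ 2 := by
  rw [dist_stripToDisc hσ hζ, mul_div_assoc', div_le_iff₀ (norm_exp_add_one_pos hζ)]
  linarith [exp_le_norm_exp_add_one hζ]

theorem le_exp_re (hσ : ‖σ‖ = 1) {ζ : ℂ} (hζ : ζ ∈ horizontalStrip) :
    2 ≤ (Real.exp ζ.re + 1) * ‖σ - stripToDisc σ ζ‖ := by
  rw [dist_stripToDisc hσ hζ, mul_div_assoc', le_div_iff₀ (norm_exp_add_one_pos hζ)]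
  linarith [norm_exp_add_one_le ζ]

/-- Points of the strip go to the right end if and only if their images go to `σ`. -/
theorem tendsto_stripToDisc_iff (hσ : ‖σ‖ = 1) {ι : Type*} {l : Filter ι} {ζ : ι → ℂ}
    (hζ : ∀ i, ζ i ∈ horizontalStrip) :
    Tendsto (fun i => stripToDisc σ (ζ i)) l (𝓝 σ) ↔ Tendsto (fun i => (ζ i).re) l atTop := by
  rw [tendsto_iff_norm_sub_tendsto_zero]
  simp only [norm_sub_rev _ σ]
  constructor
  · intro h
    have h1 : ∀ i, 0 < ‖σ - stripToDisc σ (ζ i)‖ := fun i => by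
      rw [dist_stripToDisc hσ (hζ i)]
      have := norm_exp_add_one_pos (hζ i)
      positivity
    have h2 : Tendsto (fun i => 2 * ‖σ - stripToDisc σ (ζ i)‖⁻¹ - 1) l atTop := by
      have h3 : Tendsto (fun i => ‖σ - stripToDisc σ (ζ i)‖⁻¹) l atTop :=
        tendsto_inv_nhdsGT_zero.comp (tendsto_nhdsWithin_iff.2 ⟨h, Eventually.of_forall h1⟩)
      exact tendsto_atTop_add_const_right _ _ (h3.const_mul_atTop two_pos)
    refine Real.tendsto_exp_comp_atTop.1 (tendsto_atTop_mono (fun i => ?_) h2)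
    have := le_exp_re hσ (hζ i)
    rw [← div_eq_mul_inv, sub_le_iff_le_add, div_le_iff₀ (h1 i)]
    exact this
  · intro h
    have h2 : Tendsto (fun i => 2 / Real.exp (ζ i).re) l (𝓝 0) :=
      (Real.tendsto_exp_atTop.comp h).const_div_atTop 2
    refine squeeze_zero (fun _ => norm_nonneg _) (fun i => ?_) h2
    rw [le_div_iff₀ (Real.exp_pos _), mul_comm]
    exact exp_re_le hσ (hζ i)

theorem eventually_nhdsWithin_disc_iff (hσ : ‖σ‖ = 1) {P : ℂ → Prop} :
    (∀ᶠ z in 𝓝[ball (0 : ℂ) 1] σ, P z) ↔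
      ∃ T : ℝ, ∀ ζ ∈ horizontalStrip, T < ζ.re → P (stripToDisc σ ζ) := by
  rw [eventually_nhdsWithin_iff, Metric.eventually_nhds_iff]
  constructor
  · rintro ⟨ε, hε, h⟩
    refine ⟨Real.log (2 / ε), fun ζ hζ hT => h ?_ (stripToDisc_mem_ball hσ hζ)⟩
    rw [Real.log_lt_iff_lt_exp (by positivity), div_lt_iff₀ hε] at hT
    rw [dist_comm, dist_eq_norm]
    have h1 := exp_re_le hσ hζ
    by_contra! hle
    have := mul_le_mul_of_nonneg_left hle (Real.exp_pos ζ.re).le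
    linarith
  · rintro ⟨T, hT⟩
    refine ⟨2 / (Real.exp T + 1), by positivity, fun z hz hzD => ?_⟩
    have hζ := discToStrip_mem hσ hzD
    rw [← stripToDisc_discToStrip hσ hzD] at hz ⊢
    refine hT _ hζ ?_
    rw [dist_comm, dist_eq_norm, lt_div_iff₀ (by positivity)] at hz
    have h1 := le_exp_re hσ hζ
    rw [← Real.exp_lt_exp]
    by_contra! hle
    have := mul_le_mul_of_nonneg_right (by linarith : Real.exp (discToStrip σ z).re + 1 ≤
      Real.exp T + 1) (norm_nonneg (σ - stripToDisc σ (discToStrip σ z)))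
    linarith

/-- Stolz regions correspond to narrower strips. -/
theorem lt_cos_im_of_stolz (hσ : ‖σ‖ = 1) {ζ : ℂ} (hζ : ζ ∈ horizontalStrip) {M : ℝ}
    (h : ‖σ - stripToDisc σ ζ‖ < M * (1 - ‖stripToDisc σ ζ‖)) :
    1 < 2 * M * Real.cos ζ.im := by
  set z := stripToDisc σ ζ
  have hz : ‖z‖ < 1 := by simpa using stripToDisc_mem_ball hσ hζ
  have hM : 0 < M := by
    by_contra! hM
    have := mul_nonpos_of_nonpos_of_nonneg hM (by linarith : 0 ≤ 1 - ‖z‖)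
    linarith [norm_nonneg (σ - z)]
  -- The squared norm has the closed formula 1 - |z|² = 4 e^{Re ζ} cos(Im ζ) / |e^ζ + 1|²; the
  -- factors e^{Re ζ} and |e^ζ + 1| are then compared and cancelled.
  have h1 : 1 - ‖z‖ ≤ 1 - ‖z‖ ^ 2 := by nlinarith [norm_nonneg z]
  have h2 := h.trans_le (mul_le_mul_of_nonneg_left h1 hM.le)
  rw [one_sub_norm_stripToDisc_sq hσ hζ, dist_stripToDisc hσ hζ, mul_div_assoc',
    div_lt_div_iff₀ (norm_exp_add_one_pos hζ) (pow_pos (norm_exp_add_one_pos hζ) 2),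
    Complex.exp_re] at h2
  have h3 := norm_exp_add_one_pos hζ
  have h4 := exp_le_norm_exp_add_one hζ
  have h5 : 2 * ‖Complex.exp ζ + 1‖ < M * (4 * (Real.exp ζ.re * Real.cos ζ.im)) := by
    by_contra! hle
    have := mul_le_mul_of_nonneg_right hle h3.le
    nlinarith
  have h6 := Real.exp_pos ζ.re
  by_contra! hle
  have := mul_le_mul_of_nonneg_left hle h6.le
  nlinarith

theorem stripToDisc_ofReal (σ : ℂ) (s : ℝ) : stripToDisc σ s =
    (((Real.exp s - 1) / (Real.exp s + 1) : ℝ) : ℂ) * σ := by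
  rw [stripToDisc, mul_comm]
  push_cast
  rfl

theorem exists_real_stripToDisc (σ : ℂ) {r : ℝ} (hr : r ∈ Ioo (0 : ℝ) 1) :
    ∃ s : ℝ, stripToDisc σ s = (r : ℂ) * σ := by
  have h1 : 0 < 1 - r := by linarith [hr.2]
  have h2 : 0 < 1 + r := by linarith [hr.1]
  refine ⟨Real.log ((1 + r) / (1 - r)), ?_⟩
  rw [stripToDisc_ofReal, Real.exp_log (div_pos h2 h1)]
  congr 2
  field_simp
  ring

end

/-! ### The length-area method -/

-- The real Jacobian of a holomorphic map is |F'|². The determinant of multiplication by F' is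
-- computed as the algebra norm of ℂ over ℝ.
open MeasureTheory ENNReal in
theorem lintegral_image_eq_of_injOn {F : ℂ → ℂ} {U A : Set ℂ} (hU : IsOpen U)
    (hF : DifferentiableOn ℂ F U) (hinj : InjOn F U) (hA : MeasurableSet A) (hAU : A ⊆ U)
    (lam : ℂ → ℝ≥0∞) :
    ∫⁻ w in F '' A, lam w = ∫⁻ z in A, ‖deriv F z‖ₑ ^ 2 * lam (F z) := by
  have hd : ∀ x ∈ A, HasFDerivWithinAt F
      (ContinuousLinearMap.restrictScalars ℝ (ContinuousLinearMap.toSpanSingleton ℂ (deriv F x)))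
      A x := fun x hx =>
    ((hF.differentiableAt (hU.mem_nhds (hAU hx))).hasDerivAt.hasFDerivAt.restrictScalars
      ℝ).hasFDerivWithinAt
  rw [lintegral_image_eq_lintegral_abs_det_fderiv_mul volume hA hd (hinj.mono hAU)]
  refine lintegral_congr fun z => ?_
  have hdet : (ContinuousLinearMap.restrictScalars ℝ
      (ContinuousLinearMap.toSpanSingleton ℂ (deriv F z))).det = ‖deriv F z‖ ^ 2 := by
    rw [← Complex.normSq_eq_norm_sq, ← Algebra.norm_complex_apply, Algebra.norm_apply,
      ContinuousLinearMap.det]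
    congr 1
    ext; simp [mul_comm]
  rw [hdet, abs_of_nonneg (by positivity), ENNReal.ofReal_pow (norm_nonneg _), ofReal_norm]

open MeasureTheory ENNReal in
theorem aemeasurable_comp_mk {h : ℂ → ℝ≥0∞} {I J : Set ℝ}
    (hh : AEMeasurable h (volume.restrict (Complex.re ⁻¹' I ∩ Complex.im ⁻¹' J))) :
    AEMeasurable (fun p : ℝ × ℝ => h ⟨p.1, p.2⟩)
      ((volume.restrict I).prod (volume.restrict J)) := by
  have he := Complex.volume_preserving_equiv_real_prod.symm Complex.measurableEquivRealProd
  rw [Measure.prod_restrict]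
  have := (he.restrict_preimage_emb (MeasurableEquiv.measurableEmbedding _)
    (Complex.re ⁻¹' I ∩ Complex.im ⁻¹' J))
  exact hh.comp_quasiMeasurePreserving this.quasiMeasurePreserving

open MeasureTheory ENNReal in
theorem lintegral_rectangle {h : ℂ → ℝ≥0∞} {I J : Set ℝ}
    (hh : AEMeasurable h (volume.restrict (Complex.re ⁻¹' I ∩ Complex.im ⁻¹' J))) :
    ∫⁻ z in Complex.re ⁻¹' I ∩ Complex.im ⁻¹' J, h z = ∫⁻ s in I, ∫⁻ θ in J, h ⟨s, θ⟩ := by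
  have he := Complex.volume_preserving_equiv_real_prod.symm Complex.measurableEquivRealProd
  rw [← he.setLIntegral_comp_preimage_emb (MeasurableEquiv.measurableEmbedding _)]
  rw [← lintegral_prod _ (aemeasurable_comp_mk hh), Measure.prod_restrict]
  rfl

-- The pointwise bound f ≤ 1 + f² replaces the Cauchy–Schwarz inequality.
open MeasureTheory ENNReal in
theorem lintegral_lt_top_of_sq {α : Type*} [MeasurableSpace α] {μ : Measure α} [IsFiniteMeasure μ]
    {f : α → ℝ≥0∞} (h : ∫⁻ x, f x ^ 2 ∂μ < ∞) : ∫⁻ x, f x ∂μ < ∞ := by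
  have h1 : ∀ x, f x ≤ 1 + f x ^ 2 := fun x => by
    rcases le_total (f x) 1 with h | h
    · exact h.trans le_self_add
    · exact (le_self_pow₀ h two_ne_zero).trans le_add_self
  refine (lintegral_mono h1).trans_lt ?_
  rw [lintegral_add_left measurable_const]
  rw [lintegral_one]
  exact ENNReal.add_lt_top.2 ⟨measure_lt_top _ _, h⟩

-- Here f ≤ η + f²/η pointwise: a small square integral forces a small integral, and no
-- measurability of f is needed.
open MeasureTheory ENNReal in
theorem lintegral_le_of_sq {α : Type*} [MeasurableSpace α] {μ : Measure α} {f : α → ℝ≥0∞}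
    {η : ℝ≥0∞} (h0 : η ≠ 0) (ht : η ≠ ∞) (h : ∫⁻ x, f x ^ 2 ∂μ ≤ η ^ 2) :
    ∫⁻ x, f x ∂μ ≤ η * μ univ + η := by
  have h1 : ∀ x, f x ≤ η + η⁻¹ * f x ^ 2 := fun x => by
    rcases le_total (f x) η with h | h
    · exact h.trans le_self_add
    · refine le_trans ?_ le_add_self
      rw [sq, ← mul_assoc]
      refine le_mul_of_one_le_left zero_le ?_
      rw [← ENNReal.inv_mul_cancel h0 ht]
      gcongr
  refine (lintegral_mono h1).trans ?_
  rw [lintegral_add_left measurable_const, lintegral_const,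
    lintegral_const_mul' _ _ (ENNReal.inv_ne_top.2 h0)]
  gcongr
  calc η⁻¹ * ∫⁻ x, f x ^ 2 ∂μ ≤ η⁻¹ * η ^ 2 := by gcongr
    _ = η := by rw [sq, ← mul_assoc, ENNReal.inv_mul_cancel h0 ht, one_mul]

theorem horizontalStrip_inter (I : Set ℝ) : horizontalStrip ∩ Complex.re ⁻¹' I =
    Complex.re ⁻¹' I ∩ Complex.im ⁻¹' Ioo (-(Real.pi / 2)) (Real.pi / 2) := inter_comm _ _

section energy

variable {F : ℂ → ℂ}

open MeasureTheory ENNReal in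
theorem aemeasurable_energy (hF : DifferentiableOn ℂ F horizontalStrip) {lam : ℂ → ℝ≥0∞}
    (hlam : Measurable lam) (I : Set ℝ) :
    AEMeasurable (fun z => ‖deriv F z‖ₑ ^ 2 * lam (F z))
      (volume.restrict (Complex.re ⁻¹' I ∩ Complex.im ⁻¹' Ioo (-(Real.pi / 2)) (Real.pi / 2))) := by
  have h1 : AEMeasurable F (volume.restrict horizontalStrip) :=
    hF.continuousOn.aemeasurable isOpen_horizontalStrip.measurableSet
  have h2 : AEMeasurable F (volume.restrict
      (Complex.re ⁻¹' I ∩ Complex.im ⁻¹' Ioo (-(Real.pi / 2)) (Real.pi / 2))) :=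
    h1.mono_measure (Measure.restrict_mono inter_subset_right le_rfl)
  exact ((measurable_deriv F).enorm.pow_const 2).aemeasurable.mul (hlam.comp_aemeasurable h2)

open MeasureTheory ENNReal in
theorem lintegral_stripImage (hF : DifferentiableOn ℂ F horizontalStrip)
    (hinj : InjOn F horizontalStrip) {lam : ℂ → ℝ≥0∞} (hlam : Measurable lam) {I : Set ℝ}
    (hI : MeasurableSet I) :
    ∫⁻ w in stripImage F I, lam w = ∫⁻ s in I, ∫⁻ θ in Ioo (-(Real.pi / 2)) (Real.pi / 2),
      ‖deriv F ⟨s, θ⟩‖ₑ ^ 2 * lam (F ⟨s, θ⟩) := by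
  rw [stripImage, lintegral_image_eq_of_injOn isOpen_horizontalStrip hF hinj
    (isOpen_horizontalStrip.measurableSet.inter (Complex.measurable_re hI)) inter_subset_left,
    horizontalStrip_inter, lintegral_rectangle (aemeasurable_energy hF hlam I)]

-- By Fubini. The weight 1 will give finite length of almost every line, the logarithmic weight will
-- control end points.
open MeasureTheory ENNReal in
theorem ae_energy_lt_top (hF : DifferentiableOn ℂ F horizontalStrip)
    (hinj : InjOn F horizontalStrip) {lam : ℂ → ℝ≥0∞} (hlam : Measurable lam)
    (hfin : ∫⁻ w in stripImage F univ, lam w ≠ ∞) :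
    ∀ᵐ s : ℝ, ∫⁻ θ in Ioo (-(Real.pi / 2)) (Real.pi / 2),
      ‖deriv F ⟨s, θ⟩‖ₑ ^ 2 * lam (F ⟨s, θ⟩) < ∞ := by
  rw [lintegral_stripImage hF hinj hlam MeasurableSet.univ] at hfin
  have h1 := (aemeasurable_comp_mk (aemeasurable_energy hF hlam univ)).lintegral_prod_right'
  have := ae_lt_top' h1 hfin
  rwa [Measure.restrict_univ] at this

open MeasureTheory ENNReal in
theorem volume_stripImage_ne_top {M : ℝ} (hM : ∀ ζ ∈ horizontalStrip, ‖F ζ‖ ≤ M) (I : Set ℝ) :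
    volume (stripImage F I) ≠ ∞ := by
  refine ((measure_mono ?_).trans_lt (measure_closedBall_lt_top (x := (0 : ℂ)) (r := M))).ne
  rintro _ ⟨ζ, ⟨hζ, -⟩, rfl⟩
  simpa using hM ζ hζ

open MeasureTheory ENNReal in
theorem tendsto_volume_stripImage (hF : DifferentiableOn ℂ F horizontalStrip)
    (hinj : InjOn F horizontalStrip) {M : ℝ} (hM : ∀ ζ ∈ horizontalStrip, ‖F ζ‖ ≤ M) :
    Tendsto (fun T : ℝ => volume (stripImage F (Ioi T))) atTop (𝓝 0) := by
  have h := tendsto_measure_iInter_atTop (μ := volume) (s := fun T : ℝ => stripImage F (Ioi T))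
    (fun T => (isOpen_stripImage hF hinj isOpen_Ioi).measurableSet.nullMeasurableSet)
    (fun a b hab => image_mono (inter_subset_inter_right _ (preimage_mono (Ioi_subset_Ioi hab))))
    ⟨0, volume_stripImage_ne_top hM _⟩
  have h0 : ⋂ T : ℝ, stripImage F (Ioi T) = ∅ := by
    rw [eq_empty_iff_forall_notMem]
    intro w hw
    rw [mem_iInter] at hw
    obtain ⟨ζ, ⟨hζ, -⟩, rfl⟩ := hw 0
    exact lt_irrefl _ ((mem_stripImage hinj hζ).1 (hw ζ.re))
  rw [h0, measure_empty] at h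
  exact h

open MeasureTheory ENNReal in
/-- On almost every vertical line, the image has finite length. -/
theorem ae_length_lt_top (hF : DifferentiableOn ℂ F horizontalStrip)
    (hinj : InjOn F horizontalStrip) {M : ℝ} (hM : ∀ ζ ∈ horizontalStrip, ‖F ζ‖ ≤ M) :
    ∀ᵐ s : ℝ, ∫⁻ θ in Ioo (-(Real.pi / 2)) (Real.pi / 2), ‖deriv F ⟨s, θ⟩‖ₑ < ∞ := by
  filter_upwards [ae_energy_lt_top hF hinj (lam := fun _ => 1) measurable_const
    (by simpa using volume_stripImage_ne_top hM _)] with s hs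
  refine lintegral_lt_top_of_sq ?_
  simpa using hs

open MeasureTheory ENNReal in
/-- Far to the right, every unit interval contains many abscissas of vertical lines with
short images. -/
theorem frequently_length_le (hF : DifferentiableOn ℂ F horizontalStrip)
    (hinj : InjOn F horizontalStrip) {M : ℝ} (hM : ∀ ζ ∈ horizontalStrip, ‖F ζ‖ ≤ M)
    {ε : ℝ} (hε : 0 < ε) :
    ∀ᶠ N : ℝ in atTop, ∃ᶠ s in ae (volume.restrict (Ioo N (N + 1))),
      ∫⁻ θ in Ioo (-(Real.pi / 2)) (Real.pi / 2), ‖deriv F ⟨s, θ⟩‖ₑ ≤ ENNReal.ofReal ε := by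
  have hpi := Real.pi_pos
  -- Chosen so that η π + η = ε, the bound of `lintegral_le_of_sq` on an interval of length π.
  set η : ℝ := ε / (Real.pi + 1)
  have hη : 0 < η := by positivity
  have h0 : ENNReal.ofReal η ≠ 0 := by simpa using hη
  have hη2 : (0 : ℝ≥0∞) < ENNReal.ofReal η ^ 2 := ENNReal.pow_pos (ENNReal.ofReal_pos.2 hη) 2
  -- If almost all lines of the unit window were long, each would have energy at least η², and so
  -- the window would have an image of area at least η², more than what is left beyond N.
  filter_upwards [(tendsto_volume_stripImage hF hinj hM).eventually_lt_const hη2] with N hN hcon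
  have h1 : ∀ᵐ s ∂(volume.restrict (Ioo N (N + 1))), ENNReal.ofReal η ^ 2 ≤
      ∫⁻ θ in Ioo (-(Real.pi / 2)) (Real.pi / 2), ‖deriv F ⟨s, θ⟩‖ₑ ^ 2 := by
    filter_upwards [hcon] with s hs
    by_contra! hlt
    refine hs ((lintegral_le_of_sq h0 ofReal_ne_top hlt.le).trans ?_)
    have hw : Real.pi / 2 - -(Real.pi / 2) = Real.pi := by ring
    rw [Measure.restrict_apply_univ, Real.volume_Ioo, hw, ← ENNReal.ofReal_mul hη.le,
      ← ENNReal.ofReal_add (by positivity) hη.le]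
    refine ENNReal.ofReal_le_ofReal (le_of_eq ?_)
    simp only [η]
    field_simp
  have h2 := lintegral_mono_ae h1
  have h3 : volume (stripImage F (Ioo N (N + 1))) ≤ volume (stripImage F (Ioi N)) :=
    measure_mono (image_mono (inter_subset_inter_right _ (preimage_mono Ioo_subset_Ioi_self)))
  have h4 := lintegral_stripImage hF hinj (lam := fun _ => 1) measurable_const
    (measurableSet_Ioo (a := N) (b := N + 1))
  simp only [mul_one, lintegral_const, Measure.restrict_apply_univ, one_mul] at h4
  rw [← h4, lintegral_const, Measure.restrict_apply_univ, Real.volume_Ioo] at h2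
  simp only [add_sub_cancel_left, ofReal_one, mul_one] at h2
  exact (h2.trans h3).not_gt hN

end energy

/-! ### The logarithmic density and prescribed end points -/

/-- Density near the origin whose square is integrable on the plane, while its integral along
every path to the origin diverges. -/
noncomputable def logDensity (v : ℂ) : ℝ :=
  if ‖v‖ < 1 / 2 then (‖v‖ * |Real.log ‖v‖|)⁻¹ else 0

theorem logDensity_nonneg (v : ℂ) : 0 ≤ logDensity v := by
  unfold logDensity; split_ifs <;> positivity

theorem measurable_logDensity : Measurable logDensity := by
  unfold logDensity
  exact Measurable.ite (measurableSet_lt measurable_norm measurable_const)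
    ((measurable_norm.mul (Real.measurable_log.comp measurable_norm).norm).inv) measurable_const

/-- The integrand is nonnegative with primitive -1/log r, which stays bounded at 0. -/
theorem integrableOn_inv_mul_log_sq :
    MeasureTheory.IntegrableOn (fun r : ℝ => r⁻¹ / Real.log r ^ 2) (Ioc 0 (1 / 2)) := by
  have hlog : ∀ r ∈ Ioc (0 : ℝ) (1 / 2), Real.log r < 0 := fun r hr =>
    Real.log_neg hr.1 (by linarith [hr.2])
  refine intervalIntegral.integrableOn_deriv_of_nonneg (g := fun r => -(Real.log r)⁻¹)
    (fun r hr => ?_) (fun r hr => ?_) (fun r hr => ?_)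
  · rcases hr.1.eq_or_lt with h | h
    · subst h
      have h1 : Tendsto (fun r : ℝ => -(Real.log r)⁻¹) (𝓝[>] 0) (𝓝 0) := by
        simpa using (Real.tendsto_log_nhdsGT_zero.inv_tendsto_atBot).neg
      -- The conventions log 0 = 0 and 0⁻¹ = 0 give the primitive its limit value at 0.
      have h2 : ContinuousWithinAt (fun r : ℝ => -(Real.log r)⁻¹) (Ioi 0) 0 := by
        rw [ContinuousWithinAt]; simpa using h1
      exact (continuousWithinAt_insert_self.2 h2).mono fun x hx => by
        rcases hx.1.eq_or_lt with h | h
        · exact Or.inl h.symm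
        · exact Or.inr h
    · exact (((Real.continuousAt_log h.ne').inv₀ (hlog r ⟨h, hr.2⟩).ne).neg).continuousWithinAt
  · have h0 := hlog r ⟨hr.1, hr.2.le⟩
    have := ((Real.hasDerivAt_log hr.1.ne').fun_inv h0.ne).fun_neg
    simpa [neg_div] using this
  · have := hr.1; positivity

open MeasureTheory ENNReal in
theorem lintegral_logDensity_sq : ∫⁻ v : ℂ, ENNReal.ofReal (logDensity v ^ 2) < ∞ := by
  have hpi := Real.pi_pos
  rw [← Complex.lintegral_comp_polarCoord_symm]
  set k : ℝ → ℝ≥0∞ := fun r => ENNReal.ofReal ((Ioc (0 : ℝ) (1 / 2)).indicator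
    (fun r : ℝ => r⁻¹ / Real.log r ^ 2) r) with hk
  have hle : ∀ p ∈ polarCoord.target,
      ENNReal.ofReal p.1 • ENNReal.ofReal (logDensity (Complex.polarCoord.symm p) ^ 2) ≤ k p.1 := by
    rintro ⟨r, θ⟩ hp
    have hr : 0 < r := by simpa [polarCoord] using hp.1
    rw [smul_eq_mul, ← ENNReal.ofReal_mul hr.le]
    refine ENNReal.ofReal_le_ofReal ?_
    have hn : ‖Complex.polarCoord.symm (r, θ)‖ = r := by
      rw [Complex.norm_polarCoord_symm, abs_of_pos hr]
    rw [logDensity, hn]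
    split_ifs with h
    · have hmem : r ∈ Ioc (0 : ℝ) (1 / 2) := ⟨hr, h.le⟩
      rw [indicator_of_mem hmem, inv_pow, mul_pow, sq_abs]
      refine le_of_eq ?_
      have hl : Real.log r ≠ 0 := (Real.log_neg hr (by linarith)).ne
      field_simp
    · rw [zero_pow two_ne_zero, mul_zero]
      exact indicator_nonneg (fun x hx => by have := hx.1; positivity) _
  have hkm : Measurable k := by
    refine Measurable.ennreal_ofReal (Measurable.indicator ?_ measurableSet_Ioc)
    exact measurable_inv.div (Real.measurable_log.pow_const 2)
  calc _ ≤ ∫⁻ p in polarCoord.target, k p.1 :=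
        setLIntegral_mono (hkm.comp measurable_fst) hle
    _ = ∫⁻ p, k p.1 ∂((volume.restrict (Ioi (0 : ℝ))).prod
          (volume.restrict (Ioo (-Real.pi) Real.pi))) := by
        rw [Measure.prod_restrict]; rfl
    _ = ∫⁻ r in Ioi (0 : ℝ), ∫⁻ _ in Ioo (-Real.pi) Real.pi, k r :=
        lintegral_prod _ (hkm.comp measurable_fst).aemeasurable
    _ = (∫⁻ r in Ioi (0 : ℝ), k r) * volume (Ioo (-Real.pi) Real.pi) := by
        simp only [lintegral_const, Measure.restrict_apply_univ]
        rw [lintegral_mul_const _ hkm]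
    _ < ∞ := by
        refine ENNReal.mul_lt_top ?_ (by simp)
        have hint : Integrable ((Ioc (0 : ℝ) (1 / 2)).indicator
            (fun r : ℝ => r⁻¹ / Real.log r ^ 2)) volume :=
          (integrable_indicator_iff measurableSet_Ioc).2 integrableOn_inv_mul_log_sq
        exact hint.integrableOn.lintegral_lt_top

theorem hasDerivAt_mk_im (s θ : ℝ) : HasDerivAt (fun θ : ℝ => (⟨s, θ⟩ : ℂ)) Complex.I θ := by
  have h : (fun θ : ℝ => (⟨s, θ⟩ : ℂ)) = fun θ : ℝ => (s : ℂ) + θ * Complex.I := by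
    funext θ; exact Complex.mk_eq_add_mul_I s θ
  rw [h]
  simpa using ((Complex.ofRealCLM.hasDerivAt (x := θ)).mul_const Complex.I).const_add (s : ℂ)

section

variable {F : ℂ → ℂ}

theorem hasDerivAt_vertical (hF : DifferentiableOn ℂ F horizontalStrip) (s : ℝ) {θ : ℝ}
    (hθ : θ ∈ Ioo (-(Real.pi / 2)) (Real.pi / 2)) :
    HasDerivAt (fun θ : ℝ => F ⟨s, θ⟩) (deriv F ⟨s, θ⟩ * Complex.I) θ :=
  ((hF.differentiableAt (isOpen_horizontalStrip.mem_nhds hθ)).hasDerivAt.comp_of_eq θ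
    (hasDerivAt_mk_im s θ) rfl)

/-- Along a vertical line of finite energy for the logarithmic density at `u`, the function does
not tend to `u`. -/
theorem not_tendsto_of_energy (hF : DifferentiableOn ℂ F horizontalStrip)
    (hinj : InjOn F horizontalStrip) (u : ℂ) (s : ℝ)
    (hen : MeasureTheory.IntegrableOn
      (fun θ : ℝ => ‖deriv F ⟨s, θ⟩‖ * logDensity (F ⟨s, θ⟩ - u))
      (Ioo (-(Real.pi / 2)) (Real.pi / 2)))
    {l : Filter ℝ} [NeBot l] [TendstoIxxClass Icc l l] {b : ℝ} (hlb : l ≤ 𝓝 b)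
    (hb : b ∉ Ioo (-(Real.pi / 2)) (Real.pi / 2)) (hl : Ioo (-(Real.pi / 2)) (Real.pi / 2) ∈ l) :
    ¬ Tendsto (fun θ : ℝ => F ⟨s, θ⟩) l (𝓝 u) := by
  intro hT
  -- By injectivity the value u is taken at most once on the line, at a parameter different from b.
  have hne : ∀ᶠ θ in l, F ⟨s, θ⟩ - u ≠ 0 := by
    by_cases h : ∃ θ₀ ∈ Ioo (-(Real.pi / 2)) (Real.pi / 2), F ⟨s, θ₀⟩ = u
    · obtain ⟨θ₀, hθ₀, h0⟩ := h
      have hbθ : b ≠ θ₀ := fun h => hb (h ▸ hθ₀)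
      filter_upwards [hl, hlb (isOpen_ne.mem_nhds hbθ)] with θ hθ hθ1 heq
      rw [sub_eq_zero, ← h0] at heq
      exact hθ1 (congrArg Complex.im (hinj (x₁ := ⟨s, θ⟩) (x₂ := ⟨s, θ₀⟩) hθ hθ₀ heq))
    · push Not at h
      filter_upwards [hl] with θ hθ
      exact sub_ne_zero.2 (h θ hθ)
  have hT0 : Tendsto (fun θ : ℝ => ‖F ⟨s, θ⟩ - u‖) l (𝓝 0) := by
    simpa using (hT.sub_const u).norm
  have hT1 : Tendsto (fun θ : ℝ => ‖F ⟨s, θ⟩ - u‖) l (𝓝[>] 0) :=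
    tendsto_nhdsWithin_iff.2 ⟨hT0, hne.mono fun θ h => norm_pos_iff.2 h⟩
  have hsmall : ∀ᶠ θ in l, ‖F ⟨s, θ⟩ - u‖ < 1 / 2 := hT0.eventually_lt_const (by norm_num)
  have hlog : Tendsto (fun θ : ℝ => Real.log ‖F ⟨s, θ⟩ - u‖) l atBot :=
    Real.tendsto_log_nhdsGT_zero.comp hT1
  -- If F → u, the function log(-log|F - u|) blows up, while its derivative is bounded by |F'| times
  -- the density; such a density is not integrable up to b.
  have hloglog : Tendsto (fun θ : ℝ => Real.log (-Real.log ‖F ⟨s, θ⟩ - u‖)) l atTop :=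
    Real.tendsto_log_atTop.comp (tendsto_neg_atBot_atTop.comp hlog)
  have hder : ∀ᶠ θ in l, ∃ d : ℝ, |d| ≤ ‖deriv F ⟨s, θ⟩‖ * logDensity (F ⟨s, θ⟩ - u) ∧
      HasDerivAt (fun θ : ℝ => Real.log (-Real.log ‖F ⟨s, θ⟩ - u‖)) d θ := by
    filter_upwards [hne, hsmall, hl] with θ h0 h1 hθ
    have hn : 0 < ‖F ⟨s, θ⟩ - u‖ := norm_pos_iff.2 h0
    have hlneg : Real.log ‖F ⟨s, θ⟩ - u‖ < 0 := Real.log_neg hn (by linarith)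
    have hd1 : HasDerivAt (fun θ : ℝ => F ⟨s, θ⟩ - u) (deriv F ⟨s, θ⟩ * Complex.I) θ :=
      (hasDerivAt_vertical hF s hθ).sub_const u
    have hd2 := hd1.norm_sq
    have hd3 := hd2.sqrt (by positivity)
    have hd4 : HasDerivAt (fun θ : ℝ => ‖F ⟨s, θ⟩ - u‖)
        (2 * inner ℝ (F ⟨s, θ⟩ - u) (deriv F ⟨s, θ⟩ * Complex.I) /
          (2 * ‖F ⟨s, θ⟩ - u‖)) θ := by
      simpa [Real.sqrt_sq (norm_nonneg _)] using hd3
    refine ⟨_, ?_, ((hd4.log hn.ne').fun_neg.log (neg_pos.2 hlneg).ne')⟩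
    have hin : |inner ℝ (F ⟨s, θ⟩ - u) (deriv F ⟨s, θ⟩ * Complex.I)| ≤
        ‖F ⟨s, θ⟩ - u‖ * ‖deriv F ⟨s, θ⟩‖ := by
      simpa using abs_real_inner_le_norm (F ⟨s, θ⟩ - u) (deriv F ⟨s, θ⟩ * Complex.I)
    rw [logDensity, if_pos h1, mul_div_mul_left _ _ two_ne_zero, abs_div, abs_neg, abs_neg,
      abs_div, abs_div, abs_norm, div_div, div_div, ← div_eq_mul_inv, ← mul_assoc]
    rw [div_le_div_iff₀ (by have := abs_pos.2 hlneg.ne; positivity)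
      (by have := abs_pos.2 hlneg.ne; positivity)]
    have := mul_le_mul_of_nonneg_right hin (by positivity :
      0 ≤ ‖F ⟨s, θ⟩ - u‖ * |Real.log ‖F ⟨s, θ⟩ - u‖|)
    nlinarith
  refine not_integrableOn_of_tendsto_norm_atTop_of_deriv_isBigO_filter l hl
    (hder.mono fun θ ⟨d, _, h⟩ => h.differentiableAt)
    (tendsto_norm_atTop_atTop.comp hloglog) ?_ hen
  refine Asymptotics.IsBigO.of_bound 1 (hder.mono fun θ ⟨d, hd, h⟩ => ?_)
  rw [h.deriv, one_mul, Real.norm_eq_abs]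
  exact hd.trans (le_abs_self _)

open MeasureTheory ENNReal in
/-- On almost every vertical line, neither end of the image converges to a given point. -/
theorem ae_not_tendsto (hF : DifferentiableOn ℂ F horizontalStrip)
    (hinj : InjOn F horizontalStrip) (u : ℂ) :
    ∀ᵐ s : ℝ, ¬ Tendsto (fun θ : ℝ => F ⟨s, θ⟩) (𝓝[<] (Real.pi / 2)) (𝓝 u) ∧
      ¬ Tendsto (fun θ : ℝ => F ⟨s, θ⟩) (𝓝[>] (-(Real.pi / 2))) (𝓝 u) := by
  have hpi := Real.pi_pos
  have hm : Measurable fun w => ENNReal.ofReal (logDensity (w - u) ^ 2) :=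
    ((measurable_logDensity.comp (measurable_id.sub_const u)).pow_const 2).ennreal_ofReal
  have hfin : ∫⁻ w in stripImage F univ, ENNReal.ofReal (logDensity (w - u) ^ 2) ≠ ∞ := by
    refine ((setLIntegral_le_lintegral _ _).trans_lt ?_).ne
    rw [lintegral_sub_right_eq_self (fun v => ENNReal.ofReal (logDensity v ^ 2)) u]
    exact lintegral_logDensity_sq
  filter_upwards [ae_energy_lt_top hF hinj hm hfin] with s hs
  have hsq : ∫⁻ θ in Ioo (-(Real.pi / 2)) (Real.pi / 2),
      ‖‖deriv F ⟨s, θ⟩‖ * logDensity (F ⟨s, θ⟩ - u)‖ₑ ^ 2 < ∞ := by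
    refine lt_of_eq_of_lt (lintegral_congr fun θ => ?_) hs
    rw [enorm_mul, mul_pow, enorm_norm, Real.enorm_of_nonneg (logDensity_nonneg _),
      ENNReal.ofReal_pow (logDensity_nonneg _)]
  have hmk : Measurable fun θ : ℝ => (⟨s, θ⟩ : ℂ) :=
    (continuous_iff_continuousAt.2 fun θ => (hasDerivAt_mk_im s θ).continuousAt).measurable
  have hFc : ContinuousOn (fun θ : ℝ => F ⟨s, θ⟩) (Ioo (-(Real.pi / 2)) (Real.pi / 2)) :=
    fun θ hθ => (hasDerivAt_vertical hF s hθ).continuousAt.continuousWithinAt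
  have hen : IntegrableOn (fun θ : ℝ => ‖deriv F ⟨s, θ⟩‖ * logDensity (F ⟨s, θ⟩ - u))
      (Ioo (-(Real.pi / 2)) (Real.pi / 2)) := by
    refine ⟨AEMeasurable.aestronglyMeasurable ?_, lintegral_lt_top_of_sq hsq⟩
    exact (((measurable_deriv F).comp hmk).norm.aemeasurable).mul
      (measurable_logDensity.comp_aemeasurable
        ((hFc.aemeasurable measurableSet_Ioo).sub_const u))
  exact ⟨not_tendsto_of_energy hF hinj u s hen nhdsWithin_le_nhds (by simp)
      (Ioo_mem_nhdsLT (by linarith)),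
    not_tendsto_of_energy hF hinj u s hen nhdsWithin_le_nhds (by simp)
      (Ioo_mem_nhdsGT (by linarith))⟩

end

/-! ### Vertical lines with images of finite length -/

/-- The vertical line of abscissa `s` has an image of finite length. -/
def FiniteLength (F : ℂ → ℂ) (s : ℝ) : Prop :=
  ∫⁻ θ in Ioo (-(Real.pi / 2)) (Real.pi / 2), ‖deriv F ⟨s, θ⟩‖ₑ < ⊤

theorem enorm_I : ‖Complex.I‖ₑ = 1 := by
  rw [← ofReal_norm, Complex.norm_I, ENNReal.ofReal_one]

section

variable {F : ℂ → ℂ}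

theorem continuous_mk_im (s : ℝ) : Continuous fun θ : ℝ => (⟨s, θ⟩ : ℂ) :=
  continuous_iff_continuousAt.2 fun θ => (hasDerivAt_mk_im s θ).continuousAt

theorem FiniteLength.integrableOn {s : ℝ} (hs : FiniteLength F s) :
    MeasureTheory.IntegrableOn (fun θ : ℝ => deriv F ⟨s, θ⟩ * Complex.I)
      (Ioo (-(Real.pi / 2)) (Real.pi / 2)) := by
  refine ⟨(((measurable_deriv F).comp (continuous_mk_im s).measurable).mul_const
    _).aestronglyMeasurable, ?_⟩
  refine lt_of_eq_of_lt (MeasureTheory.lintegral_congr fun θ => ?_) hs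
  rw [enorm_mul, enorm_I, mul_one]

theorem integral_vertical (hF : DifferentiableOn ℂ F horizontalStrip) {s : ℝ}
    (hs : FiniteLength F s) {θ θ' : ℝ} (hθ : θ ∈ Ioo (-(Real.pi / 2)) (Real.pi / 2))
    (hθ' : θ' ∈ Ioo (-(Real.pi / 2)) (Real.pi / 2)) :
    ∫ x in θ..θ', deriv F ⟨s, x⟩ * Complex.I = F ⟨s, θ'⟩ - F ⟨s, θ⟩ := by
  have hsub : uIcc θ θ' ⊆ Ioo (-(Real.pi / 2)) (Real.pi / 2) := ordConnected_Ioo.uIcc_subset hθ hθ'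
  exact intervalIntegral.integral_eq_sub_of_hasDerivAt
    (fun x hx => hasDerivAt_vertical hF s (hsub hx))
    ((hs.integrableOn.mono_set hsub).intervalIntegrable)

/-- The image of a vertical line of finite length extends continuously to the end points. -/
theorem FiniteLength.exists_continuous (hF : DifferentiableOn ℂ F horizontalStrip) {s : ℝ}
    (hs : FiniteLength F s) :
    ∃ u : ℝ → ℂ, Continuous u ∧ ∀ θ ∈ Ioo (-(Real.pi / 2)) (Real.pi / 2), u θ = F ⟨s, θ⟩ := by
  have hpi := Real.pi_pos
  have h0 : (0 : ℝ) ∈ Ioo (-(Real.pi / 2)) (Real.pi / 2) := by constructor <;> linarith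
  have hint := (MeasureTheory.integrable_indicator_iff measurableSet_Ioo).2 hs.integrableOn
  refine ⟨fun θ => F ⟨s, 0⟩ + ∫ x in (0 : ℝ)..θ, (Ioo (-(Real.pi / 2)) (Real.pi / 2)).indicator
    (fun x : ℝ => deriv F ⟨s, x⟩ * Complex.I) x, ?_, fun θ hθ => ?_⟩
  · exact continuous_const.add
      (intervalIntegral.continuous_primitive (fun a b => hint.intervalIntegrable) 0)
  · have hsub : uIcc 0 θ ⊆ Ioo (-(Real.pi / 2)) (Real.pi / 2) := ordConnected_Ioo.uIcc_subset h0 hθ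
    beta_reduce
    rw [intervalIntegral.integral_congr (g := fun x : ℝ => deriv F ⟨s, x⟩ * Complex.I)
      (fun x hx => indicator_of_mem (hsub hx) _), integral_vertical hF hs h0 hθ]
    ring

theorem norm_sub_le_of_length_le (hF : DifferentiableOn ℂ F horizontalStrip) {s ε : ℝ}
    (hε : 0 ≤ ε) (hs : ∫⁻ θ in Ioo (-(Real.pi / 2)) (Real.pi / 2), ‖deriv F ⟨s, θ⟩‖ₑ ≤
      ENNReal.ofReal ε) {θ θ' : ℝ} (hθ : θ ∈ Ioo (-(Real.pi / 2)) (Real.pi / 2))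
    (hθ' : θ' ∈ Ioo (-(Real.pi / 2)) (Real.pi / 2)) : ‖F ⟨s, θ'⟩ - F ⟨s, θ⟩‖ ≤ ε := by
  have hfin : FiniteLength F s := hs.trans_lt ENNReal.ofReal_lt_top
  have hsub : uIoc θ θ' ⊆ Ioo (-(Real.pi / 2)) (Real.pi / 2) :=
    uIoc_subset_uIcc.trans (ordConnected_Ioo.uIcc_subset hθ hθ')
  rw [← integral_vertical hF hfin hθ hθ', intervalIntegral.norm_intervalIntegral_eq]
  rw [← ENNReal.ofReal_le_ofReal_iff hε, ofReal_norm]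
  refine (MeasureTheory.enorm_integral_le_lintegral_enorm _).trans ?_
  refine le_trans (MeasureTheory.lintegral_mono_set hsub) ?_
  refine le_of_eq_of_le (MeasureTheory.lintegral_congr fun θ => ?_) hs
  rw [enorm_mul, enorm_I, mul_one]

end

/-! ### Null-chains of vertical lines -/

/-- `G` is, on the strip, univalent and a quadratic rational function of the bounded univalent
function `F`. -/
structure BoundedFactor (G F : ℂ → ℂ) (a b : ℂ) (M : ℝ) : Prop where
  diff : DifferentiableOn ℂ G horizontalStrip
  inj : InjOn G horizontalStrip
  diff_factor : DifferentiableOn ℂ F horizontalStrip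
  inj_factor : InjOn F horizontalStrip
  norm_le : ∀ ζ ∈ horizontalStrip, ‖F ζ‖ ≤ M
  quad : ∀ ζ ∈ horizontalStrip, sphereQuad a b (F ζ) = G ζ

namespace BoundedFactor

variable {G F : ℂ → ℂ} {a b : ℂ} {M : ℝ}

theorem isOpen_image (h : BoundedFactor G F a b M) : IsOpen (G '' horizontalStrip) :=
  isOpen_image_of_injOn isOpen_horizontalStrip convex_horizontalStrip.isPreconnected h.diff h.inj
    Subset.rfl isOpen_horizontalStrip

theorem toSphere_stripImage (h : BoundedFactor G F a b M) {s : ℝ} {u : ℝ → ℂ}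
    (hu : ∀ θ ∈ Ioo (-(Real.pi / 2)) (Real.pi / 2), u θ = F ⟨s, θ⟩) :
    toSphere (stripImage G {s}) =
      (fun θ => sphereQuad a b (u θ)) '' Ioo (-(Real.pi / 2)) (Real.pi / 2) := by
  ext p
  constructor
  · rintro ⟨_, ⟨ζ, ⟨hζ, hs⟩, rfl⟩, rfl⟩
    refine ⟨ζ.im, hζ, ?_⟩
    have hs' : ζ.re = s := hs
    have hζe : (⟨s, ζ.im⟩ : ℂ) = ζ := Complex.ext hs'.symm rfl
    simp only
    rw [hu _ hζ, hζe, h.quad ζ hζ]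
  · rintro ⟨θ, hθ, rfl⟩
    refine ⟨G ⟨s, θ⟩, ⟨⟨s, θ⟩, ⟨hθ, rfl⟩, rfl⟩, ?_⟩
    simp only
    rw [hu θ hθ, h.quad _ hθ]

/-- Limits along vertical lines towards the edges of the strip lie on the boundary. -/
theorem mem_frontier (h : BoundedFactor G F a b M) {s : ℝ} {u : ℝ → ℂ}
    (huc : Continuous u) (hu : ∀ θ ∈ Ioo (-(Real.pi / 2)) (Real.pi / 2), u θ = F ⟨s, θ⟩) {e : ℝ}
    (he : |e| = Real.pi / 2) : sphereQuad a b (u e) ∈ frontier (toSphere (G '' horizontalStrip)) := by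
  have hpi := Real.pi_pos
  have hc : Continuous fun θ => sphereQuad a b (u θ) := (continuous_sphereQuad a b).comp huc
  have hecl : e ∈ closure (Ioo (-(Real.pi / 2)) (Real.pi / 2)) := by
    rw [closure_Ioo (by linarith)]; exact abs_le.1 he.le
  rw [(isOpen_toSphere h.isOpen_image).frontier_eq]
  refine ⟨?_, ?_⟩
  · have h1 : sphereQuad a b (u e) ∈ closure (toSphere (stripImage G {s})) := by
      rw [h.toSphere_stripImage hu]
      exact hc.continuousWithinAt.mem_closure_image hecl
    exact closure_mono (image_mono (stripImage_subset _)) h1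
  · rintro ⟨_, ⟨ζ, hζ, rfl⟩, hζe⟩
    -- Were the limit an interior value G(ζ), points of the line with |θ| > c would have images in
    -- the open image of the substrip |Im| < c, against injectivity.
    obtain ⟨c, hc1, hc2⟩ := exists_between (abs_lt.2 hζ : |ζ.im| < Real.pi / 2)
    set A : Set ℂ := horizontalStrip ∩ Complex.im ⁻¹' Ioo (-c) c
    have hA : IsOpen (G '' A) :=
      isOpen_image_of_injOn isOpen_horizontalStrip convex_horizontalStrip.isPreconnected h.diff
        h.inj inter_subset_left
        (isOpen_horizontalStrip.inter (isOpen_Ioo.preimage Complex.continuous_im))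
    have hmem : (fun θ => sphereQuad a b (u θ)) ⁻¹' toSphere (G '' A) ∈ 𝓝 e := by
      refine hc.continuousAt.preimage_mem_nhds ((isOpen_toSphere hA).mem_nhds ?_)
      rw [← hζe]
      exact coe_mem_toSphere.2 ⟨ζ, ⟨hζ, abs_lt.1 hc1⟩, rfl⟩
    have hfar : {θ : ℝ | c < |θ|} ∈ 𝓝 e :=
      (isOpen_lt continuous_const continuous_abs).mem_nhds (by simpa [he] using hc2)
    obtain ⟨θ, ⟨hθ1, hθ2⟩, hθ⟩ := mem_closure_iff_nhds.1 hecl _ (inter_mem hmem hfar)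
    have hθ3 : sphereQuad a b (u θ) ∈ toSphere (G '' A) := hθ1
    rw [hu θ hθ, h.quad _ hθ, coe_mem_toSphere] at hθ3
    obtain ⟨ξ, ⟨hξ, hξc⟩, hξe⟩ := hθ3
    have hξθ : ξ = ⟨s, θ⟩ := h.inj hξ hθ hξe
    rw [hξθ] at hξc
    exact lt_asymm (abs_lt.2 hξc) hθ2

/-- Finite length extends F continuously to both ends of the line, and the quadratic map carries the
extension to the sphere. The parameter is x ↦ π(x - 1/2) on [0, 1]. -/
theorem isCrosscut (h : BoundedFactor G F a b M) {s : ℝ} (hs : FiniteLength F s) :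
    IsCrosscut (G '' horizontalStrip) (stripImage G {s}) := by
  have hpi := Real.pi_pos
  obtain ⟨u, huc, hu⟩ := hs.exists_continuous h.diff_factor
  refine ⟨stripImage_subset _, fun x => sphereQuad a b (u (Real.pi * (x - 1 / 2))), ?_, ?_, ?_,
    ?_, ?_⟩
  · exact ((continuous_sphereQuad a b).comp (huc.comp (by fun_prop))).continuousOn
  · intro x hx y hy hxy
    have hmem : ∀ x ∈ Ioo (0 : ℝ) 1, Real.pi * (x - 1 / 2) ∈
        Ioo (-(Real.pi / 2)) (Real.pi / 2) := fun x hx => by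
      constructor <;> nlinarith [hx.1, hx.2]
    simp only at hxy
    rw [hu _ (hmem x hx), hu _ (hmem y hy), h.quad _ (hmem x hx), h.quad _ (hmem y hy),
      OnePoint.coe_eq_coe] at hxy
    have h1 := congrArg Complex.im (h.inj (x₁ := ⟨s, _⟩) (x₂ := ⟨s, _⟩) (hmem x hx) (hmem y hy) hxy)
    have h2 := mul_left_cancel₀ hpi.ne' h1
    linarith
  · have himg : (fun x : ℝ => Real.pi * (x - 1 / 2)) '' Ioo 0 1 =
        Ioo (-(Real.pi / 2)) (Real.pi / 2) := by
      ext θ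
      constructor
      · rintro ⟨x, hx, rfl⟩
        constructor <;> nlinarith [hx.1, hx.2]
      · intro hθ
        refine ⟨θ / Real.pi + 1 / 2, ⟨?_, ?_⟩, by field_simp; ring⟩
        · rw [← sub_lt_iff_lt_add, lt_div_iff₀ hpi]; linarith [hθ.1]
        · rw [← lt_sub_iff_add_lt, div_lt_iff₀ hpi]; linarith [hθ.2]
    rw [h.toSphere_stripImage hu, ← himg, image_image]
  · refine h.mem_frontier huc hu ?_
    rw [abs_of_neg (by nlinarith)]
    ring
  · refine h.mem_frontier huc hu ?_
    rw [abs_of_pos (by nlinarith)]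
    ring

theorem closure_subset (h : BoundedFactor G F a b M) {s : ℝ} {u : ℝ → ℂ}
    (huc : Continuous u) (hu : ∀ θ ∈ Ioo (-(Real.pi / 2)) (Real.pi / 2), u θ = F ⟨s, θ⟩) :
    closure (toSphere (stripImage G {s})) ⊆ toSphere (stripImage G {s}) ∪
      {sphereQuad a b (u (Real.pi / 2)), sphereQuad a b (u (-(Real.pi / 2)))} := by
  have hpi := Real.pi_pos
  have hc : Continuous fun θ => sphereQuad a b (u θ) := (continuous_sphereQuad a b).comp huc
  rw [h.toSphere_stripImage hu]
  refine (closure_minimal (image_mono Ioo_subset_Icc_self)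
    (isCompact_Icc.image hc).isClosed).trans ?_
  rintro _ ⟨θ, hθ, rfl⟩
  rcases hθ.1.eq_or_lt with h1 | h1
  · subst h1; exact Or.inr (Or.inr rfl)
  rcases hθ.2.eq_or_lt with h2 | h2
  · subst h2; exact Or.inr (Or.inl rfl)
  · exact Or.inl ⟨θ, ⟨h1, h2⟩, rfl⟩

/-- The closures of the images of almost all vertical lines are disjoint from the closure of the
image of a given one. -/
theorem ae_disjoint_closure (h : BoundedFactor G F a b M) {s : ℝ} (hs : FiniteLength F s) :
    ∀ᵐ t : ℝ, t ≠ s → Disjoint (closure (toSphere (stripImage G {s})))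
      (closure (toSphere (stripImage G {t}))) := by
  have hpi := Real.pi_pos
  obtain ⟨u, huc, hu⟩ := hs.exists_continuous h.diff_factor
  set E : Set (OnePoint ℂ) := {sphereQuad a b (u (Real.pi / 2)), sphereQuad a b (u (-(Real.pi / 2)))}
    with hE
  -- Only finitely many values of F lie over the end points of the given line, so almost every other
  -- line ends over none of them.
  have hfib : {v | sphereQuad a b v ∈ E}.Finite := by
    refine ((finite_sphereQuad_fiber a b (u (Real.pi / 2))).union
      (finite_sphereQuad_fiber a b (u (-(Real.pi / 2))))).subset fun v hv => hv
  have hae := (MeasureTheory.ae_ball_iff (μ := MeasureTheory.volume) hfib.countable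
    (p := fun t v _ => ¬ Tendsto (fun θ : ℝ => F ⟨t, θ⟩) (𝓝[<] (Real.pi / 2)) (𝓝 v) ∧
      ¬ Tendsto (fun θ : ℝ => F ⟨t, θ⟩) (𝓝[>] (-(Real.pi / 2))) (𝓝 v))).2
    fun v _ => ae_not_tendsto h.diff_factor h.inj_factor v
  filter_upwards [hae, ae_length_lt_top h.diff_factor h.inj_factor h.norm_le] with t ht hlen hts
  obtain ⟨v, hvc, hv⟩ := FiniteLength.exists_continuous h.diff_factor hlen
  have hends : ∀ p ∈ ({sphereQuad a b (v (Real.pi / 2)), sphereQuad a b (v (-(Real.pi / 2)))} :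
      Set (OnePoint ℂ)), p ∉ E ∧ p ∈ frontier (toSphere (G '' horizontalStrip)) := by
    rintro _ (rfl | rfl)
    · refine ⟨fun hp => (ht _ hp).1 ?_, h.mem_frontier hvc hv (abs_of_pos (by linarith))⟩
      refine (hvc.continuousWithinAt.tendsto).congr' ?_
      filter_upwards [Ioo_mem_nhdsLT (by linarith : -(Real.pi / 2) < Real.pi / 2)] with θ hθ
        using hv θ hθ
    · refine ⟨fun hp => (ht _ hp).2 ?_, h.mem_frontier hvc hv
        (by rw [abs_neg]; exact abs_of_pos (by linarith))⟩
      refine (hvc.continuousWithinAt.tendsto).congr' ?_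
      filter_upwards [Ioo_mem_nhdsGT (by linarith : -(Real.pi / 2) < Real.pi / 2)] with θ hθ
        using hv θ hθ
  have hEf : ∀ p ∈ E, p ∈ frontier (toSphere (G '' horizontalStrip)) := by
    rintro _ (rfl | rfl)
    · exact h.mem_frontier huc hu (abs_of_pos (by linarith))
    · exact h.mem_frontier huc hu (by rw [abs_neg]; exact abs_of_pos (by linarith))
  rw [(isOpen_toSphere h.isOpen_image).frontier_eq] at hends hEf
  rw [Set.disjoint_left]
  intro p hps hpt
  -- Interior points are separated by injectivity, an interior point from an end point because Ω is
  -- open, and end points from each other by the choice of t.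
  rcases h.closure_subset huc hu hps with hp1 | hp1 <;>
    rcases h.closure_subset hvc hv hpt with hp2 | hp2
  · obtain ⟨x, hx, rfl⟩ := hp1
    rw [coe_mem_toSphere] at hp2
    exact Set.disjoint_left.1 (disjoint_stripImage h.inj (by simpa using hts.symm)) hx hp2
  · exact (hends p hp2).2.2 (image_mono (stripImage_subset _) hp1)
  · exact (hEf p hp1).2 (image_mono (stripImage_subset _) hp2)
  · exact (hends p hp2).1 hp1

/-- Vertical lines at abscissas near prescribed large ones form a null-chain. -/
theorem exists_nullChain (h : BoundedFactor G F a b M) {x : ℕ → ℝ}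
    (hx : Tendsto x atTop atTop) :
    ∃ (V : NullChain (G '' horizontalStrip)) (t : ℕ → ℝ) (k : ℕ → ℕ), StrictMono t ∧
      Tendsto t atTop atTop ∧ (∀ n, V.cut n = stripImage G {t n}) ∧ Tendsto k atTop atTop ∧
      ∀ n, t n ∈ Ioo (x (k n)) (x (k n) + 1) := by
  have hstep : ∀ (n : ℕ) (s : {s : ℝ // FiniteLength F s}), ∃ (k : ℕ)
      (t : {t : ℝ // FiniteLength F t}), n ≤ k ∧ s.1 < t.1 ∧ t.1 ∈ Ioo (x k) (x k + 1) ∧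
      ∫⁻ θ in Ioo (-(Real.pi / 2)) (Real.pi / 2), ‖deriv F ⟨t.1, θ⟩‖ₑ ≤
        ENNReal.ofReal (1 / ((n : ℝ) + 1)) ∧
      Disjoint (closure (toSphere (stripImage G {s.1})))
        (closure (toSphere (stripImage G {t.1}))) := by
    intro n s
    obtain ⟨k, hkn, hks, hfreq⟩ := ((eventually_ge_atTop n).and
      ((hx.eventually_gt_atTop s.1).and (hx.eventually (frequently_length_le h.diff_factor
        h.inj_factor h.norm_le (by positivity : (0 : ℝ) < 1 / ((n : ℝ) + 1)))))).exists
    have hev := MeasureTheory.ae_restrict_of_ae (s := Ioo (x k) (x k + 1))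
      (h.ae_disjoint_closure s.2)
    obtain ⟨t, ⟨ht1, ht2⟩, ht3⟩ := ((hfreq.and_eventually hev).and_eventually
      (MeasureTheory.ae_restrict_mem measurableSet_Ioo)).exists
    have hst : s.1 < t := hks.trans ht3.1
    exact ⟨k, ⟨t, ht1.trans_lt ENNReal.ofReal_lt_top⟩, hkn, hst, ht3, ht1, ht2 hst.ne'⟩
  choose k t hk hlt hmem hlen hdisj using hstep
  obtain ⟨s₀, hs₀⟩ := (ae_length_lt_top h.diff_factor h.inj_factor h.norm_le).exists
  -- The seed s₀ is not used as a cut: the n-th cut is `seq (n + 1)`, so that every cut has the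
  -- length bound 1/(n + 1) and lies in a prescribed window.
  let seq : ℕ → {s : ℝ // FiniteLength F s} := fun n => Nat.rec ⟨s₀, hs₀⟩ t n
  have hseq : ∀ n, seq (n + 1) = t n (seq n) := fun n => rfl
  have hmono : StrictMono fun n => (seq (n + 1)).1 :=
    strictMono_nat_of_lt_succ fun n => by rw [hseq (n + 1)]; exact hlt _ _
  have hcut : ∀ n, (seq (n + 1)).1 ∈ Ioo (x (k n (seq n))) (x (k n (seq n)) + 1) := fun n => by
    rw [hseq]; exact hmem _ _
  have hktop : Tendsto (fun n => k n (seq n)) atTop atTop :=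
    tendsto_atTop_mono (fun n => hk _ _) tendsto_id
  refine ⟨⟨fun n => stripImage G {(seq (n + 1)).1}, fun n => h.isCrosscut (seq (n + 1)).2,
    fun n => ?_, fun n hn => ?_, fun ε hε => ?_⟩, fun n => (seq (n + 1)).1,
    fun n => k n (seq n), hmono, ?_, fun n => rfl, hktop, hcut⟩
  · rw [hseq (n + 1)]; exact hdisj _ _
  · exact separates_stripImage h.diff h.inj (hmono (Nat.pos_of_ne_zero (by omega)))
      (hmono (Nat.lt_succ_self n))
  · obtain ⟨δ, hδ, hclose⟩ := exists_chordalDist_lt_of_sphereQuad a b M hε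
    filter_upwards [tendsto_one_div_add_atTop_nhds_zero_nat.eventually_lt_const hδ] with n hn
    rintro _ ⟨ζ, ⟨hζ, hζs⟩, rfl⟩ _ ⟨ξ, ⟨hξ, hξs⟩, rfl⟩
    refine hclose _ _ _ _ (h.norm_le ζ hζ) (h.norm_le ξ hξ) ?_ (h.quad ζ hζ) (h.quad ξ hξ)
    have hl := hlen n (seq n)
    rw [← hseq] at hl
    have h1 := norm_sub_le_of_length_le h.diff_factor (by positivity) hl hξ hζ
    have hζe : (⟨(seq (n + 1)).1, ζ.im⟩ : ℂ) = ζ := Complex.ext hζs.symm rfl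
    have hξe : (⟨(seq (n + 1)).1, ξ.im⟩ : ℂ) = ξ := Complex.ext hξs.symm rfl
    rw [hζe, hξe] at h1
    rw [dist_eq_norm]
    exact h1.trans_lt hn
  · exact tendsto_atTop_mono (fun n => (hcut n).1.le) (hx.comp hktop)

end BoundedFactor

/-! ### Mean values and decay of the derivative in narrower strips -/

open MeasureTheory ENNReal in
/-- The circle mean value inequality. -/
theorem enorm_mul_le_lintegral_circle {h : ℂ → ℂ} {c : ℂ} {r : ℝ} (hr : 0 < r)
    (hh : DifferentiableOn ℂ h (closedBall c r)) :
    ‖h c‖ₑ * ENNReal.ofReal (2 * Real.pi) ≤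
      ∫⁻ θ in Ioo (-Real.pi) Real.pi, ‖h (c + Complex.polarCoord.symm (r, θ))‖ₑ := by
  have hpi := Real.pi_pos
  have hd : DiffContOnCl ℂ h (ball c |r|) := by
    rw [abs_of_pos hr]
    exact (hh.mono closure_ball_subset_closedBall).diffContOnCl
  have hav := hd.circleAverage
  have hper : Function.Periodic (fun θ : ℝ => h (circleMap c r θ)) (2 * Real.pi) := fun θ => by
    simp only [periodic_circleMap c r θ]
  have hint : ∫ θ in (-Real.pi)..Real.pi, h (circleMap c r θ) = (2 * Real.pi : ℝ) • h c := by
    have h1 := hper.intervalIntegral_add_eq (-Real.pi) 0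
    rw [show -Real.pi + 2 * Real.pi = Real.pi by ring, zero_add] at h1
    rw [h1, ← hav, Real.circleAverage, smul_smul, mul_inv_cancel₀ (by positivity), one_smul]
  have hpt : ∀ θ : ℝ, c + Complex.polarCoord.symm (r, θ) = circleMap c r θ := fun θ => by
    rw [Complex.polarCoord_symm_apply, circleMap, Complex.exp_mul_I]
    push_cast
    ring
  simp only [hpt]
  calc ‖h c‖ₑ * ENNReal.ofReal (2 * Real.pi)
      = ‖∫ θ in (-Real.pi)..Real.pi, h (circleMap c r θ)‖ₑ := by
        rw [hint, enorm_smul, Real.enorm_of_nonneg (by positivity), mul_comm]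
    _ ≤ ∫⁻ θ in Ioc (-Real.pi) Real.pi, ‖h (circleMap c r θ)‖ₑ := by
        rw [intervalIntegral.integral_of_le (by linarith)]
        exact enorm_integral_le_lintegral_enorm _
    _ = ∫⁻ θ in Ioo (-Real.pi) Real.pi, ‖h (circleMap c r θ)‖ₑ :=
        setLIntegral_congr Ioo_ae_eq_Ioc.symm

open MeasureTheory ENNReal in
/-- The area mean value inequality, up to a constant. -/
theorem enorm_mul_le_lintegral_ball {h : ℂ → ℂ} (hm : Measurable h) {c : ℂ} {R : ℝ} (hR : 0 < R)
    (hh : DifferentiableOn ℂ h (ball c R)) :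
    ‖h c‖ₑ * ENNReal.ofReal (Real.pi * R ^ 2 / 2) ≤ ∫⁻ z in ball c R, ‖h z‖ₑ := by
  have hpi := Real.pi_pos
  have hball : MeasurableSet (ball c R) := measurableSet_ball
  set k : ℂ → ℝ≥0∞ := (ball c R).indicator fun z => ‖h z‖ₑ
  have hkm : Measurable k := hm.enorm.indicator hball
  rw [← lintegral_indicator hball, ← lintegral_add_left_eq_self _ c,
    ← Complex.lintegral_comp_polarCoord_symm]
  have hpm : Measurable fun p : ℝ × ℝ => Complex.polarCoord.symm p := by
    have : (fun p : ℝ × ℝ => Complex.polarCoord.symm p) =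
        fun p : ℝ × ℝ => (p.1 : ℂ) * (Real.cos p.2 + Real.sin p.2 * Complex.I) := by
      funext p
      exact Complex.polarCoord_symm_apply p
    rw [this]
    fun_prop
  have hmeas : Measurable fun p : ℝ × ℝ =>
      ENNReal.ofReal p.1 • k (c + Complex.polarCoord.symm p) :=
    measurable_fst.ennreal_ofReal.mul (hkm.comp (measurable_const.add hpm))
  -- Only radii between R/2 and R are kept, with weight at least R/2; the constant is
  -- (R/2)(R/2)(2π).
  calc ‖h c‖ₑ * ENNReal.ofReal (Real.pi * R ^ 2 / 2)
      = ∫⁻ _ in Ioo (R / 2) R, ENNReal.ofReal (R / 2) *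
          (‖h c‖ₑ * ENNReal.ofReal (2 * Real.pi)) := by
        rw [setLIntegral_const, Real.volume_Ioo, mul_left_comm, mul_assoc,
          ← ENNReal.ofReal_mul (by positivity), ← ENNReal.ofReal_mul (by positivity)]
        congr 2
        ring
    _ ≤ ∫⁻ r in Ioo (R / 2) R, ∫⁻ θ in Ioo (-Real.pi) Real.pi,
          ENNReal.ofReal r • k (c + Complex.polarCoord.symm (r, θ)) := by
        refine setLIntegral_mono' measurableSet_Ioo fun r hr => ?_
        have hr0 : 0 < r := by linarith [hr.1]
        have hcirc := enorm_mul_le_lintegral_circle hr0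
          (hh.mono (closedBall_subset_ball hr.2))
        simp only [smul_eq_mul]
        rw [lintegral_const_mul' _ _ ENNReal.ofReal_ne_top]
        refine mul_le_mul' (ENNReal.ofReal_le_ofReal hr.1.le) (hcirc.trans (le_of_eq ?_))
        refine lintegral_congr fun θ => ?_
        have hmem : c + Complex.polarCoord.symm (r, θ) ∈ ball c R := by
          rw [mem_ball, dist_self_add_left, Complex.norm_polarCoord_symm, abs_of_pos hr0]
          exact hr.2
        exact (indicator_of_mem hmem fun z => ‖h z‖ₑ).symm
    _ = ∫⁻ p in Ioo (R / 2) R ×ˢ Ioo (-Real.pi) Real.pi,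
          ENNReal.ofReal p.1 • k (c + Complex.polarCoord.symm p) := by
        rw [Measure.volume_eq_prod, ← Measure.prod_restrict, lintegral_prod _ hmeas.aemeasurable]
    _ ≤ ∫⁻ p in polarCoord.target, ENNReal.ofReal p.1 • k (c + Complex.polarCoord.symm p) := by
        refine lintegral_mono_set (prod_mono (fun r hr => ?_) Subset.rfl)
        have : 0 < r := by linarith [hr.1]
        exact this

section

variable {F : ℂ → ℂ}

open MeasureTheory ENNReal in
/-- The derivative of a bounded univalent function of the strip tends to zero at the right end of
narrower strips. -/
theorem eventually_norm_deriv_le (hF : DifferentiableOn ℂ F horizontalStrip)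
    (hinj : InjOn F horizontalStrip) {M : ℝ} (hM : ∀ ζ ∈ horizontalStrip, ‖F ζ‖ ≤ M) {c ε : ℝ}
    (hc : 0 < c) (hε : 0 < ε) :
    ∀ᶠ T : ℝ in atTop, ∀ ζ : ℂ, |ζ.im| ≤ Real.pi / 2 - c → T ≤ ζ.re → ‖deriv F ζ‖ ≤ ε := by
  have hpi := Real.pi_pos
  have hpos : (0 : ℝ≥0∞) < ENNReal.ofReal (ε ^ 2 * (Real.pi * c ^ 2 / 2)) :=
    ENNReal.ofReal_pos.2 (by positivity)
  obtain ⟨T, hT⟩ := ((tendsto_volume_stripImage hF hinj hM).eventually_lt_const hpos).exists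
  -- The margin c keeps the disc of radius c about ζ inside the strip and beyond T. The mean value
  -- inequality for F'² bounds |F'(ζ)|² by the area of the image of that disc, divided by πc²/2.
  filter_upwards [eventually_ge_atTop (T + c)] with T' hTT' ζ hζ hre
  have hball : ball ζ c ⊆ horizontalStrip ∩ Complex.re ⁻¹' Ioi T := by
    intro z hz
    rw [mem_ball, dist_eq_norm] at hz
    have h1 := abs_le.1 hζ
    have h2 := abs_lt.1 ((Complex.abs_im_le_norm (z - ζ)).trans_lt hz)
    have h3 := abs_lt.1 ((Complex.abs_re_le_norm (z - ζ)).trans_lt hz)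
    rw [Complex.sub_im] at h2
    rw [Complex.sub_re] at h3
    refine ⟨⟨by linarith [h1.1, h2.1], by linarith [h1.2, h2.2]⟩, ?_⟩
    rw [mem_preimage, mem_Ioi]
    linarith [h3.1]
  have hd : DifferentiableOn ℂ (fun z => deriv F z ^ 2) (ball ζ c) :=
    ((hF.deriv isOpen_horizontalStrip).mono (hball.trans inter_subset_left)).pow 2
  have h1 := enorm_mul_le_lintegral_ball ((measurable_deriv F).pow_const 2) hc hd
  have h2 : ∫⁻ z in ball ζ c, ‖deriv F z ^ 2‖ₑ ≤ volume (stripImage F (Ioi T)) := by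
    have h3 := lintegral_image_eq_of_injOn isOpen_horizontalStrip hF hinj
      (isOpen_horizontalStrip.measurableSet.inter (Complex.measurable_re measurableSet_Ioi))
      (inter_subset_left (t := Complex.re ⁻¹' Ioi T)) (fun _ => 1)
    simp only [mul_one, lintegral_const, Measure.restrict_apply_univ, one_mul] at h3
    rw [stripImage, h3]
    refine (lintegral_mono_set hball).trans (le_of_eq (lintegral_congr fun z => ?_))
    rw [enorm_pow]
  have h4 := (h1.trans h2).trans_lt hT
  by_contra! hlt
  refine absurd h4 (not_lt.2 ?_)
  rw [ENNReal.ofReal_mul (by positivity), enorm_pow, ← ofReal_norm,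
    ← ENNReal.ofReal_pow (norm_nonneg _)]
  gcongr

/-- A narrower half-strip is convex, so the mean value inequality applies between the two points,
whose distance is at most B + π. -/
theorem tendsto_norm_sub_of_narrow (hF : DifferentiableOn ℂ F horizontalStrip)
    (hinj : InjOn F horizontalStrip) {M : ℝ} (hM : ∀ ζ ∈ horizontalStrip, ‖F ζ‖ ≤ M) {c B : ℝ}
    (hc : 0 < c) {ζ ξ : ℕ → ℂ} (hζ : ∀ n, |(ζ n).im| ≤ Real.pi / 2 - c)
    (hξ : ∀ n, |(ξ n).im| ≤ Real.pi / 2 - c) (hζt : Tendsto (fun n => (ζ n).re) atTop atTop)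
    (hξt : Tendsto (fun n => (ξ n).re) atTop atTop) (hB : ∀ n, |(ζ n).re - (ξ n).re| ≤ B) :
    Tendsto (fun n => ‖F (ζ n) - F (ξ n)‖) atTop (𝓝 0) := by
  have hpi := Real.pi_pos
  have hB0 : 0 ≤ B := (abs_nonneg _).trans (hB 0)
  rw [Metric.tendsto_atTop']
  intro ε hε
  have hK : 0 < B + Real.pi := by positivity
  obtain ⟨T, hT⟩ := (eventually_norm_deriv_le hF hinj hM hc
    (by positivity : 0 < ε / (2 * (B + Real.pi)))).exists
  obtain ⟨N, hN⟩ := eventually_atTop.1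
    ((hζt.eventually_ge_atTop T).and (hξt.eventually_ge_atTop T))
  refine ⟨N, fun n hn => ?_⟩
  rw [Real.dist_0_eq_abs, abs_norm]
  have hconv : Convex ℝ (Complex.im ⁻¹' Icc (-(Real.pi / 2 - c)) (Real.pi / 2 - c) ∩
      Complex.re ⁻¹' Ici T) :=
    ((convex_Icc _ _).linear_preimage Complex.imLm).inter
      ((convex_Ici _).linear_preimage Complex.reLm)
  have hmem : ∀ z ∈ Complex.im ⁻¹' Icc (-(Real.pi / 2 - c)) (Real.pi / 2 - c) ∩
      Complex.re ⁻¹' Ici T, z ∈ horizontalStrip := fun z hz =>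
    ⟨by linarith [hz.1.1], by linarith [hz.1.2]⟩
  have h1 := hconv.norm_image_sub_le_of_norm_deriv_le (f := F)
    (fun z hz => hF.differentiableAt (isOpen_horizontalStrip.mem_nhds (hmem z hz)))
    (fun z hz => hT z (abs_le.2 hz.1) hz.2)
    ⟨abs_le.1 (hξ n), (hN n hn.le).2⟩ ⟨abs_le.1 (hζ n), (hN n hn.le).1⟩
  have h2 : ‖ζ n - ξ n‖ ≤ B + Real.pi := by
    refine (Complex.norm_le_abs_re_add_abs_im _).trans (add_le_add (by simpa using hB n) ?_)
    have h3 := abs_le.1 (hζ n)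
    have h4 := abs_le.1 (hξ n)
    rw [Complex.sub_im, abs_le]
    constructor <;> linarith [h3.1, h3.2, h4.1, h4.2]
  calc ‖F (ζ n) - F (ξ n)‖ ≤ ε / (2 * (B + Real.pi)) * ‖ζ n - ξ n‖ := h1
    _ ≤ ε / (2 * (B + Real.pi)) * (B + Real.pi) := by gcongr
    _ = ε / 2 := by field_simp
    _ < ε := by linarith

end

/-! ### The prime end at the right end of the strip -/

namespace BoundedFactor

variable {G F : ℂ → ℂ} {a b : ℂ} {M : ℝ}

/-- Sequences of a narrower strip going to the right end with bounded mutual distance have the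
same limits. -/
theorem tendsto_of_narrow (h : BoundedFactor G F a b M) {c B : ℝ}
    (hc : 0 < c) {ζ ξ : ℕ → ℂ} (hζ : ∀ n, |(ζ n).im| ≤ Real.pi / 2 - c)
    (hξ : ∀ n, |(ξ n).im| ≤ Real.pi / 2 - c) (hζt : Tendsto (fun n => (ζ n).re) atTop atTop)
    (hξt : Tendsto (fun n => (ξ n).re) atTop atTop) (hB : ∀ n, |(ζ n).re - (ξ n).re| ≤ B)
    {p : OnePoint ℂ} (hp : Tendsto (fun n => (G (ζ n) : OnePoint ℂ)) atTop (𝓝 p)) :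
    Tendsto (fun n => (G (ξ n) : OnePoint ℂ)) atTop (𝓝 p) := by
  have hmem : ∀ z : ℂ, |z.im| ≤ Real.pi / 2 - c → z ∈ horizontalStrip := fun z hz =>
    abs_lt.1 (hz.trans_lt (by linarith))
  refine tendsto_sphere_of_chordalDist hp ?_
  have hd := tendsto_norm_sub_of_narrow h.diff_factor h.inj_factor h.norm_le hc hζ hξ hζt hξt hB
  rw [Metric.tendsto_atTop']
  intro ε hε
  obtain ⟨δ, hδ, hclose⟩ := exists_chordalDist_lt_of_sphereQuad a b M hε
  obtain ⟨N, hN⟩ := eventually_atTop.1 (hd.eventually_lt_const hδ)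
  refine ⟨N, fun n hn => ?_⟩
  rw [Real.dist_0_eq_abs, abs_of_nonneg (chordalDist_nonneg _ _)]
  have h1 := hmem _ (hζ n)
  have h2 := hmem _ (hξ n)
  exact hclose _ _ _ _ (h.norm_le _ h1) (h.norm_le _ h2) (by rw [dist_eq_norm]; exact hN n hn.le)
    (h.quad _ h1) (h.quad _ h2)

/-- The right end of the strip corresponds to exactly one prime end, whose principal part is the
cluster set along the real axis. -/
theorem exists_primeEnd (h : BoundedFactor G F a b M) {Ω : Set ℂ} (hΩ : Ω = G '' horizontalStrip) :
    ∃ p : PrimeEnd Ω, (∀ q : PrimeEnd Ω, (∀ C : NullChain Ω, C.Represents q → ∀ n, 1 ≤ n →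
        ∃ T : ℝ, stripImage G (Ioi T) ⊆ C.interiorPart n) ↔ q = p) ∧
      p.principalPart = {x | ∃ s : ℕ → ℝ, Tendsto s atTop atTop ∧
        Tendsto (fun n => (G (s n) : OnePoint ℂ)) atTop (𝓝 x)} := by
  subst hΩ
  obtain ⟨V, t, -, htm, htop, hV, -⟩ := h.exists_nullChain tendsto_natCast_atTop_atTop
  have hright : ∀ C : NullChain (G '' horizontalStrip), C.Represents (Quotient.mk _ V) →
      ∀ n, 1 ≤ n → ∃ T : ℝ, stripImage G (Ioi T) ⊆ C.interiorPart n := by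
    intro C hC n hn
    have hCV : C.Equivalent V := Quotient.exact hC
    obtain ⟨m, hm, hsub⟩ := hCV.1 n hn
    rw [interiorPart_of_cut_eq h.diff h.inj htm hV hm] at hsub
    exact ⟨t m, hsub⟩
  refine ⟨Quotient.mk _ V, fun q => ⟨fun hq => ?_, ?_⟩, Subset.antisymm ?_ ?_⟩
  · obtain ⟨C, rfl⟩ := Quotient.exists_rep q
    exact Quotient.sound (equivalent_of_right_end h.diff h.inj htm htop hV C (hq C rfl))
  · rintro rfl
    exact hright
  · rintro x ⟨C, hC, ζ, hζ, hζx⟩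
    exact exists_real_tendsto_of_mem_cut h.diff h.inj C (hright C hC) hζ hζx
  · rintro x ⟨s, hs, hsx⟩
    -- The chain is built near the abscissas s, so its real points `t' n` are within 1 of `s (k n)`
    -- and have the same limit under G.
    obtain ⟨V', t', k, htm', htop', hV', hk, hmem⟩ := h.exists_nullChain hs
    refine ⟨V', Quotient.sound (equivalent_of_right_end h.diff h.inj htm htop hV V'
      fun n hn => ⟨t' n, ?_⟩), fun n => G (t' n), fun n => ?_, ?_⟩
    · rw [interiorPart_of_cut_eq h.diff h.inj htm' hV' hn]
    · rw [hV']
      exact (mem_stripImage h.inj (ofReal_mem_horizontalStrip _)).2 (by simp)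
    · have hpi := Real.pi_pos
      refine h.tendsto_of_narrow (c := Real.pi / 2) (B := 1) (ζ := fun n => (s (k n) : ℂ))
        (by positivity) (by simp) (by simp) ?_ ?_ (fun n => ?_) (hsx.comp hk)
      · simpa [Function.comp_def] using hs.comp hk
      · simpa using htop'
      · have := hmem n
        simp only [Complex.ofReal_re]
        rw [abs_le]
        constructor <;> linarith [this.1, this.2]

end BoundedFactor

/-! ### Stolz regions and hyperbolic steps seen in the strip -/

section disc

variable {σ : ℂ}

theorem exists_narrow_of_stolz (hσ : ‖σ‖ = 1) (M : ℝ) :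
    ∃ c > 0, c < Real.pi / 2 ∧ ∀ ζ ∈ horizontalStrip,
      ‖σ - stripToDisc σ ζ‖ < M * (1 - ‖stripToDisc σ ζ‖) → |ζ.im| ≤ Real.pi / 2 - c := by
  have hpi := Real.pi_pos
  -- A Stolz region gives cos(Im ζ) > 1/(2M), so arccos bounds |Im ζ|. The maximum with 1 gives 0 <
  -- κ < 1 for every real M, so that arccos κ lies strictly between 0 and π/2.
  set κ : ℝ := 1 / (2 * max M 1)
  have hM : 0 < max M 1 := lt_max_of_lt_right one_pos
  have hκ : 0 < κ := by positivity
  have hκ1 : κ < 1 := by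
    simp only [κ]
    rw [div_lt_one (by positivity)]
    linarith [le_max_right M 1]
  refine ⟨Real.pi / 2 - Real.arccos κ, sub_pos.2 (Real.arccos_lt_pi_div_two.2 hκ), ?_,
    fun ζ hζ h => ?_⟩
  · have := Real.arccos_pos.2 hκ1
    linarith
  · have h1 := lt_cos_im_of_stolz hσ hζ h
    have h2 : |ζ.im| < Real.pi / 2 := abs_lt.2 hζ
    have h3 : 0 < Real.cos ζ.im := Real.cos_pos_of_mem_Ioo hζ
    have h4 : κ ≤ Real.cos |ζ.im| := by
      rw [Real.cos_abs]
      simp only [κ]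
      rw [div_le_iff₀ (by positivity)]
      nlinarith [le_max_left M 1]
    rw [sub_sub_cancel, ← Real.arccos_cos (abs_nonneg ζ.im) (by linarith)]
    exact Real.arccos_le_arccos h4

/-- A sequence of hyperbolically bounded steps approaches a boundary point at bounded rate. -/
theorem norm_sub_le_of_hyperbolicDist_le (hσ : ‖σ‖ = 1) {z w : ℂ} {K : ℝ}
    (hz : z ∈ ball (0 : ℂ) 1) (hw : w ∈ ball (0 : ℂ) 1) (h : hyperbolicDist z w ≤ K) :
    ‖σ - z‖ ≤ (4 * Real.exp (2 * K) + 2) * ‖σ - w‖ := by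
  have hσz := norm_pos_iff.2 (sub_ne_zero_of_mem_ball hσ hz)
  have hσw := norm_pos_iff.2 (sub_ne_zero_of_mem_ball hσ hw)
  rw [mem_ball_zero_iff] at hz hw
  set N := ‖1 - (starRingEnd ℂ) z * w‖ with hN
  have hzw : ‖(starRingEnd ℂ) z * w‖ < 1 := by
    rw [norm_mul, RCLike.norm_conj]
    nlinarith [norm_nonneg z, norm_nonneg w]
  have hNpos : 0 < N := by
    refine norm_pos_iff.2 (sub_ne_zero.2 fun h => ?_)
    rw [← h, norm_one] at hzw
    exact lt_irrefl _ hzw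
  have hid : N ^ 2 - ‖z - w‖ ^ 2 = (1 - ‖z‖ ^ 2) * (1 - ‖w‖ ^ 2) := by
    rw [hN]
    simp only [← Complex.normSq_eq_norm_sq, Complex.normSq_apply, Complex.sub_re, Complex.sub_im,
      Complex.mul_re, Complex.mul_im, Complex.conj_re, Complex.conj_im, Complex.one_re,
      Complex.one_im]
    ring
  set ρ := ‖z - w‖ / N with hρ
  have hρ0 : 0 ≤ ρ := by positivity
  have hρN : ‖z - w‖ = ρ * N := by rw [hρ]; field_simp
  have hz1 : 0 < 1 - ‖z‖ ^ 2 := by nlinarith [norm_nonneg z]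
  have hw1 : 0 < 1 - ‖w‖ ^ 2 := by nlinarith [norm_nonneg w]
  have hρ1 : ρ < 1 := by
    rw [hρ, div_lt_one hNpos]
    refine lt_of_pow_lt_pow_left₀ 2 hNpos.le ?_
    nlinarith [mul_pos hz1 hw1]
  have hL : (1 + ρ) / (1 - ρ) ≤ Real.exp (2 * K) := by
    have h1 : Real.log ((1 + ρ) / (1 - ρ)) ≤ 2 * K := by
      have : (1 / 2) * Real.log ((1 + ρ) / (1 - ρ)) ≤ K := h
      linarith
    exact (Real.log_le_iff_le_exp (div_pos (by linarith) (by linarith))).1 h1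
  rw [div_le_iff₀ (by linarith)] at hL
  have hLpos := Real.exp_pos (2 * K)
  set L := Real.exp (2 * K)
  -- Multiply 1 + ρ ≤ L(1 - ρ) by 1 + ρ ≥ 1.
  have hsum : 1 ≤ L * (1 - ρ ^ 2) := by nlinarith
  have hup : N ^ 2 ≤ L * (4 * (‖σ - z‖ * ‖σ - w‖)) := by
    have h1 : 1 - ‖z‖ ≤ ‖σ - z‖ := by
      have := norm_sub_norm_le σ z
      rwa [hσ] at this
    have h2 : 1 - ‖w‖ ≤ ‖σ - w‖ := by
      have := norm_sub_norm_le σ w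
      rwa [hσ] at this
    have h3 : 1 - ‖z‖ ^ 2 ≤ 2 * ‖σ - z‖ := by nlinarith [norm_nonneg z]
    have h4 : 1 - ‖w‖ ^ 2 ≤ 2 * ‖σ - w‖ := by nlinarith [norm_nonneg w]
    have h5 : (1 - ‖z‖ ^ 2) * (1 - ‖w‖ ^ 2) ≤ 2 * ‖σ - z‖ * (2 * ‖σ - w‖) :=
      mul_le_mul h3 h4 hw1.le (by positivity)
    have h6 : N ^ 2 * (1 - ρ ^ 2) = (1 - ‖z‖ ^ 2) * (1 - ‖w‖ ^ 2) := by
      rw [← hid, hρN]; ring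
    calc N ^ 2 = N ^ 2 * 1 := (mul_one _).symm
      _ ≤ N ^ 2 * (L * (1 - ρ ^ 2)) := by gcongr
      _ = L * ((1 - ‖z‖ ^ 2) * (1 - ‖w‖ ^ 2)) := by rw [← h6]; ring
      _ ≤ L * (4 * (‖σ - z‖ * ‖σ - w‖)) := by
        refine mul_le_mul_of_nonneg_left (h5.trans (le_of_eq (by ring))) hLpos.le
  -- Since |σ| = 1, |1 - conj(z) σ| = |σ - z|; replacing σ by w costs at most |σ - w|.
  have hlow : ‖σ - z‖ - ‖σ - w‖ ≤ N := by
    have h1 : ‖1 - (starRingEnd ℂ) z * σ‖ = ‖σ - z‖ := by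
      have h2 : (1 : ℂ) - (starRingEnd ℂ) z * σ = (starRingEnd ℂ) (σ - z) * σ := by
        rw [map_sub, sub_mul, ← Complex.normSq_eq_conj_mul_self, Complex.normSq_eq_norm_sq, hσ]
        norm_num
      rw [h2, norm_mul, RCLike.norm_conj, hσ, mul_one]
    have h3 : (1 : ℂ) - (starRingEnd ℂ) z * σ =
        (1 - (starRingEnd ℂ) z * w) - (starRingEnd ℂ) z * (σ - w) := by ring
    have h4 := norm_sub_le (1 - (starRingEnd ℂ) z * w) ((starRingEnd ℂ) z * (σ - w))
    rw [← h3, h1, norm_mul, RCLike.norm_conj] at h4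
    nlinarith
  by_cases hle : ‖σ - z‖ ≤ ‖σ - w‖
  · nlinarith
  · push Not at hle
    -- With x = |σ - z| and y = |σ - w|, expanding (x - y)² ≤ 4Lxy gives x² ≤ (4L + 2)xy, and x is
    -- cancelled.
    have h1 : (‖σ - z‖ - ‖σ - w‖) ^ 2 ≤ L * (4 * (‖σ - z‖ * ‖σ - w‖)) :=
      (pow_le_pow_left₀ (by linarith) hlow 2).trans hup
    refine le_of_mul_le_mul_left ?_ hσz
    nlinarith [sq_nonneg ‖σ - w‖]

theorem exists_re_step_le (hσ : ‖σ‖ = 1) (K : ℝ) :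
    ∃ B : ℝ, 0 ≤ B ∧ ∀ ζ ∈ horizontalStrip, ∀ ξ ∈ horizontalStrip, 0 ≤ ζ.re →
      hyperbolicDist (stripToDisc σ ζ) (stripToDisc σ ξ) ≤ K → ξ.re ≤ ζ.re + B := by
  set A := 4 * Real.exp (2 * K) + 2
  have hA : 2 ≤ A := by simp only [A]; linarith [Real.exp_pos (2 * K)]
  -- A bounds the ratio of the distances to σ; the factor 2 absorbs e^{Re ζ} + 1 ≤ 2 e^{Re ζ}, valid
  -- for Re ζ ≥ 0.
  refine ⟨Real.log (2 * A), Real.log_nonneg (by linarith), fun ζ hζ ξ hξ h0 h => ?_⟩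
  have h1 := norm_sub_le_of_hyperbolicDist_le hσ (stripToDisc_mem_ball hσ hζ)
    (stripToDisc_mem_ball hσ hξ) h
  have h2 := le_exp_re hσ hζ
  have h3 := exp_re_le hσ hξ
  have hx := norm_pos_iff.2 (sub_ne_zero_of_mem_ball hσ (stripToDisc_mem_ball hσ hξ))
  have h4 : 1 ≤ Real.exp ζ.re := Real.one_le_exp h0
  rw [← Real.exp_le_exp, Real.exp_add, Real.exp_log (by linarith)]
  refine le_of_mul_le_mul_right ?_ hx
  calc Real.exp ξ.re * ‖σ - stripToDisc σ ξ‖ ≤ 2 := h3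
    _ ≤ (Real.exp ζ.re + 1) * ‖σ - stripToDisc σ ζ‖ := h2
    _ ≤ (2 * Real.exp ζ.re) * (A * ‖σ - stripToDisc σ ξ‖) :=
      mul_le_mul (by linarith) h1 (norm_nonneg _) (by positivity)
    _ = Real.exp ζ.re * (2 * A) * ‖σ - stripToDisc σ ξ‖ := by ring

end disc

/-- If the steps of `x` are eventually bounded, `x` comes near all large numbers. -/
theorem exists_near_of_bounded_steps {x s : ℕ → ℝ} {B : ℝ} (hB : 0 ≤ B)
    (hx : Tendsto x atTop atTop)
    (hstep : ∀ n, 0 ≤ x n → x (n + 1) ≤ x n + B) (hs : Tendsto s atTop atTop) :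
    ∃ j n : ℕ → ℕ, Tendsto j atTop atTop ∧ Tendsto n atTop atTop ∧
      ∀ m, |s (j m) - x (n m)| ≤ B := by
  obtain ⟨N, hN⟩ := eventually_atTop.1 (hx.eventually_ge_atTop 0)
  have key : ∀ m : ℕ, ∃ j n : ℕ, m ≤ j ∧ m ≤ n ∧ |s j - x n| ≤ B := by
    intro m
    obtain ⟨j, hjm, hj⟩ := ((eventually_ge_atTop m).and
      (hs.eventually_ge_atTop (x (max m N)))).exists
    -- At the first index where x exceeds `s j`, the preceding value is at most `s j` and within one
    -- step of it. That index is not the initial one, since `s j` was chosen at least `x (max m N)`.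
    have hex : ∃ i, s j < x (max m N + i) := by
      obtain ⟨n, hn1, hn2⟩ := ((eventually_ge_atTop (max m N)).and
        (hx.eventually_gt_atTop (s j))).exists
      exact ⟨n - max m N, by rwa [Nat.add_sub_cancel' hn1]⟩
    classical
    obtain ⟨i, hi⟩ : ∃ i, Nat.find hex = i + 1 := by
      refine Nat.exists_eq_succ_of_ne_zero fun h0 => ?_
      have := Nat.find_spec hex
      rw [h0, add_zero] at this
      linarith
    have h1 : x (max m N + i) ≤ s j := not_lt.1 (Nat.find_min hex (by omega))
    have h2 := Nat.find_spec hex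
    rw [hi, ← add_assoc] at h2
    have h3 := hstep (max m N + i) (hN _ (by omega))
    exact ⟨j, max m N + i, hjm, by omega, abs_le.2 ⟨(neg_nonpos.2 hB).trans (sub_nonneg.2 h1), by linarith⟩⟩
  choose j n hj hn hjn using key
  exact ⟨j, n, tendsto_atTop_mono hj tendsto_id, tendsto_atTop_mono hn tendsto_id, hjn⟩

/-! ### Transfer to the disc and comparison of the cluster sets -/

theorem exists_boundedFactor {g : ℂ → ℂ} (hg : DifferentiableOn ℂ g (ball (0 : ℂ) 1))
    (hinj : InjOn g (ball (0 : ℂ) 1)) {σ : ℂ} (hσ : ‖σ‖ = 1) :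
    ∃ (F : ℂ → ℂ) (a b : ℂ) (M : ℝ), BoundedFactor (g ∘ stripToDisc σ) F a b M := by
  obtain ⟨a, b, M, f, hf, hfinj, hfg⟩ := exists_bounded_factor hg hinj
  have hmaps : MapsTo (stripToDisc σ) horizontalStrip (ball (0 : ℂ) 1) :=
    fun ζ hζ => stripToDisc_mem_ball hσ hζ
  refine ⟨f ∘ stripToDisc σ, a, b, M, hg.comp (differentiableOn_stripToDisc σ) hmaps,
    hinj.comp (injOn_stripToDisc hσ) hmaps, hf.comp (differentiableOn_stripToDisc σ) hmaps,
    hfinj.comp (injOn_stripToDisc hσ) hmaps, fun ζ hζ => (hfg _ (hmaps hζ)).1, fun ζ hζ => ?_⟩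
  obtain ⟨-, h0, h1⟩ := hfg _ (hmaps hζ)
  simp only [Function.comp_apply]
  rw [sphereQuad_of_ne h0, h1]

/-- The radial cluster set is the cluster set along the real axis of the strip. -/
theorem radialClusterSet_eq (g : ℂ → ℂ) {σ : ℂ} (hσ : ‖σ‖ = 1) :
    radialClusterSet g σ = {x | ∃ s : ℕ → ℝ, Tendsto s atTop atTop ∧
      Tendsto (fun n => ((g ∘ stripToDisc σ) (s n) : OnePoint ℂ)) atTop (𝓝 x)} := by
  have hmem := ofReal_mem_horizontalStrip
  ext p
  constructor
  · rintro ⟨r, hr, hr1, hp⟩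
    choose s hs using fun n => exists_real_stripToDisc σ (hr n)
    refine ⟨s, ?_, ?_⟩
    · have h1 : Tendsto (fun n => stripToDisc σ (s n : ℝ)) atTop (𝓝 σ) := by
        simp only [hs]
        have h2 : Tendsto (fun n => (r n : ℂ)) atTop (𝓝 ((1 : ℝ) : ℂ)) :=
          (Complex.continuous_ofReal.tendsto 1).comp hr1
        simpa using h2.mul_const σ
      simpa using (tendsto_stripToDisc_iff hσ fun n => hmem (s n)).1 h1
    · simpa only [Function.comp_apply, hs] using hp
  · rintro ⟨s, hs, hp⟩
    obtain ⟨N, hN⟩ := eventually_atTop.1 (hs.eventually_gt_atTop 0)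
    have hs' : Tendsto (fun n => s (n + N)) atTop atTop := hs.comp (tendsto_add_atTop_nat N)
    -- The shift by N makes s positive, as needed for radii in (0, 1).
    refine ⟨fun n => (Real.exp (s (n + N)) - 1) / (Real.exp (s (n + N)) + 1), fun n => ?_, ?_, ?_⟩
    · have h1 : 1 < Real.exp (s (n + N)) := Real.one_lt_exp_iff.2 (hN _ (by omega))
      exact ⟨div_pos (by linarith) (by linarith), (div_lt_one (by linarith)).2 (by linarith)⟩
    · have h1 : ∀ n, (Real.exp (s (n + N)) - 1) / (Real.exp (s (n + N)) + 1) =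
          1 - 2 / (Real.exp (s (n + N)) + 1) := fun n => by
        have := Real.exp_pos (s (n + N))
        field_simp
        ring
      simp only [h1]
      have h2 : Tendsto (fun n => 2 / (Real.exp (s (n + N)) + 1)) atTop (𝓝 0) :=
        (tendsto_atTop_add_const_right _ 1 (Real.tendsto_exp_atTop.comp hs')).const_div_atTop 2
      simpa using h2.const_sub 1
    · have h1 := hp.comp (tendsto_add_atTop_nat N)
      refine h1.congr fun n => ?_
      simp only [Function.comp_apply, stripToDisc_ofReal]

/-- On the radius |σ - rσ| = 1 - r, so any Stolz constant above 1 works; 2 is used. -/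
theorem radialClusterSet_subset (g : ℂ → ℂ) {σ : ℂ} (hσ : ‖σ‖ = 1) :
    radialClusterSet g σ ⊆ nonTangentialClusterSet g σ := by
  rintro p ⟨r, hr, hr1, hp⟩
  refine ⟨fun n => (r n : ℂ) * σ, ⟨fun n => ?_, ?_, 2, fun n => ?_⟩, hp⟩
  · rw [mem_ball_zero_iff, norm_mul, hσ, mul_one, Complex.norm_real, Real.norm_eq_abs,
      abs_of_pos (hr n).1]
    exact (hr n).2
  · have h2 : Tendsto (fun n => (r n : ℂ)) atTop (𝓝 ((1 : ℝ) : ℂ)) :=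
      (Complex.continuous_ofReal.tendsto 1).comp hr1
    simpa using h2.mul_const σ
  · have h1 : σ - (r n : ℂ) * σ = ((1 - r n : ℝ) : ℂ) * σ := by push_cast; ring
    rw [h1, norm_mul, norm_mul, hσ, mul_one, mul_one, Complex.norm_real, Complex.norm_real,
      Real.norm_eq_abs, Real.norm_eq_abs, abs_of_pos (hr n).1, abs_of_pos (by linarith [(hr n).2])]
    linarith [(hr n).2]

/-- A non-tangential sequence, seen in the strip. -/
theorem TendstoNonTangentially.exists_strip {z : ℕ → ℂ} {σ : ℂ} (hσ : ‖σ‖ = 1)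
    (hz : TendstoNonTangentially z σ) : ∃ c > 0, c < Real.pi / 2 ∧ ∃ ζ : ℕ → ℂ,
      (∀ n, ζ n ∈ horizontalStrip ∧ stripToDisc σ (ζ n) = z n ∧ |(ζ n).im| ≤ Real.pi / 2 - c) ∧
      Tendsto (fun n => (ζ n).re) atTop atTop := by
  obtain ⟨hball, hlim, M, hM⟩ := hz
  obtain ⟨c, hc, hc2, hnarrow⟩ := exists_narrow_of_stolz hσ M
  have hmem : ∀ n, discToStrip σ (z n) ∈ horizontalStrip := fun n => discToStrip_mem hσ (hball n)
  have heq : ∀ n, stripToDisc σ (discToStrip σ (z n)) = z n :=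
    fun n => stripToDisc_discToStrip hσ (hball n)
  refine ⟨c, hc, hc2, fun n => discToStrip σ (z n), fun n => ⟨hmem n, heq n,
    hnarrow _ (hmem n) ?_⟩, ?_⟩
  · rw [heq]; exact hM n
  · rw [← tendsto_stripToDisc_iff hσ hmem]
    simpa only [heq] using hlim

theorem proposition2p1 (g : ℂ → ℂ) (hg : DifferentiableOn ℂ g (ball (0 : ℂ) 1))
    (hinj : InjOn g (ball (0 : ℂ) 1)) (σ : ℂ) (hσ : ‖σ‖ = 1) (w : ℕ → ℂ)
    (hw : TendstoNonTangentially w σ)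
    (hstep : ∃ K : ℝ, 0 < K ∧ ∀ n, hyperbolicDist (w n) (w (n + 1)) ≤ K) :
    ∃ p : PrimeEnd (g '' ball (0 : ℂ) 1),
      (∀ q : PrimeEnd (g '' ball (0 : ℂ) 1), IsPrimeEndAt g σ q ↔ q = p) ∧
      p.principalPart = radialClusterSet g σ ∧
      radialClusterSet g σ = nonTangentialClusterSet g σ ∧
      nonTangentialClusterSet g σ = sequenceClusterSet g w := by
  obtain ⟨F, a, b, M, h⟩ := exists_boundedFactor hg hinj hσ
  have hΩ : g '' ball (0 : ℂ) 1 = (g ∘ stripToDisc σ) '' horizontalStrip := by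
    rw [image_comp, image_stripToDisc hσ]
  obtain ⟨p, hp, hprin⟩ := h.exists_primeEnd hΩ
  have hNR : nonTangentialClusterSet g σ ⊆ radialClusterSet g σ := by
    rintro x ⟨z, hz, hx⟩
    obtain ⟨c, hc, hc2, ζ, hζ, hre⟩ := hz.exists_strip hσ
    rw [radialClusterSet_eq g hσ]
    refine ⟨fun n => (ζ n).re, hre, ?_⟩
    -- Projection to the real axis keeps the real part, hence B = 0.
    refine h.tendsto_of_narrow (ζ := ζ) (ξ := fun n => ((ζ n).re : ℂ)) (B := 0) hc
      (fun n => (hζ n).2.2) (fun n => by simpa using hc2.le) hre (by simpa using hre) (by simp) ?_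
    simpa only [Function.comp_apply, (hζ _).2.1] using hx
  have hWN : sequenceClusterSet g w ⊆ nonTangentialClusterSet g σ := by
    rintro x ⟨φ, hφ, hx⟩
    obtain ⟨hball, hlim, K, hK⟩ := hw
    exact ⟨w ∘ φ, ⟨fun n => hball _, hlim.comp hφ.tendsto_atTop, K, fun n => hK _⟩, hx⟩
  have hRW : radialClusterSet g σ ⊆ sequenceClusterSet g w := by
    rw [radialClusterSet_eq g hσ]
    rintro x ⟨s, hs, hx⟩
    obtain ⟨c, hc, hc2, ω, hω, hre⟩ := hw.exists_strip hσ
    obtain ⟨K, -, hK⟩ := hstep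
    obtain ⟨B, hB, hstepB⟩ := exists_re_step_le hσ K
    obtain ⟨j, n, hj, hn, hjn⟩ := exists_near_of_bounded_steps hB hre
      (fun n h0 => hstepB _ (hω n).1 _ (hω (n + 1)).1 h0 (by
        rw [(hω n).2.1, (hω (n + 1)).2.1]; exact hK n)) hs
    have h1 := h.tendsto_of_narrow (ζ := fun m => (s (j m) : ℂ)) (ξ := fun m => ω (n m)) (B := B)
      hc (fun m => by simpa using hc2.le) (fun m => (hω _).2.2)
      (by simpa [Function.comp_def] using hs.comp hj) (hre.comp hn) (by simpa using hjn)
      (hx.comp hj)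
    -- The matching indices n tend to infinity but need not increase, so a subsequence is taken.
    obtain ⟨φ, hφ, hnφ⟩ := strictMono_subseq_of_tendsto_atTop hn
    refine ⟨n ∘ φ, hnφ, ?_⟩
    have h2 := h1.comp hφ.tendsto_atTop
    refine h2.congr fun m => ?_
    simp only [Function.comp_apply, (hω _).2.1]
  have hRN := radialClusterSet_subset g hσ
  refine ⟨p, fun q => ?_, hprin.trans (radialClusterSet_eq g hσ).symm, hRN.antisymm hNR,
    (hNR.trans hRW).antisymm hWN⟩
  rw [← hp q]
  refine forall_congr' fun C => imp_congr_right fun _ => forall_congr' fun n =>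
    imp_congr_right fun _ => ?_
  rw [eventually_nhdsWithin_disc_iff hσ]
  refine exists_congr fun T => ⟨?_, fun hT ζ hζ hζT => hT ⟨ζ, ⟨hζ, hζT⟩, rfl⟩⟩
  rintro hT _ ⟨ζ, ⟨hζ, hζT⟩, rfl⟩
  exact hT ζ hζ hζT
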